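/- Let $X$ be a compact connected Riemann surface with holomorphic cotangent bundle $K_X$, and let $n\ge 2$, $m\ge 2$ be integers. A generalized $\mathrm{SO}(2n,\mathbb C)$-quasioper of length $2m+1$ on $X$ is a quadruple $(E,B_0,\mathcal F_\bullet,D)$ of the following kind. $E$ is a holomorphic vector bundle of rank $2n$ on $X$ with $\det E\cong\mathcal O_X$, and $B_0\in H^0(X,\mathrm{Sym}^2(E^*))$ is fiberwise nondegenerate. $\mathcal F_\bullet$ is a filtration $0=F_0\subset F_1\subset\cdots\subset F_{2m+1}=E$ by holomorphic subbundles with $\operatorname{rank}(F_{m+1}/F_m)=2\operatorname{rank}(F_1)$, $\operatorname{rank}(F_i/F_{i-1})=\operatorname{rank}(F_1)$ for $i\in\{1,\dots,2m+1\}\setminus\{m+1\}$, and $F_i^{\perp}=F_{2m+1-i}$ for $0\le i\le m$. $D:E\to E\otimes K_X$ is a holomorphic connection with $d\,B_0(s,t)=B_0(Ds,t)+B_0(s,Dt)$ for local holomorphic sections $s,t$ of $E$ and $D(F_i)\subset F_{i+1}\otimes K_X$ for $1\le i\le 2m$, such that the second fundamental form $S(D,i):F_i/F_{i-1}\to(F_{i+1}/F_i)\otimes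 K_X$ is an isomorphism for $i\in\{1,\dots,2m\}\setminus\{m,m+1\}$ and the composition $(S(D,m+1)\otimes\mathrm{Id}_{K_X})\circ S(D,m):F_m/F_{m-1}\to(F_{m+2}/F_{m+1})\otimes K_X^{\otimes 2}$ is an isomorphism. For a holomorphic vector bundle $W$ with a holomorphic connection $D_W$ and a holomorphic subbundle $V\subset W$, let $\widehat D_W(V)$ be the smallest holomorphic subbundle of $W$ that contains $V$ and satisfies $D_W(V)\subset\widehat D_W(V)\otimes K_X$; let $\widehat D_W^{k}(V)$ be its $k$-fold iterate. Given a generalized $\mathrm{SO}(2n,\mathbb C)$-quasioper $(E,B_0,\mathcal F_\bullet,D)$ of length $2m+1$, put $\mathbb F:=\widehat D_E^{2m}(F_1)\subset E$. Let $D^*$ be the connection on $E^*$ induced by $D$, let $G_1\subset E^*$ be the kernel of the restriction map $E^*\to F_{2m}^*$, put $\mathbb G:=\widehat{(D^*)}_{E^*}^{2m}(G_1)\subset E^*$, and let $\mathcal S:=(E^*/\mathbb G)^*\subset E^{**}=E$ be the image of the dual of the quotient map $E^*\to E^*/\mathbb G$. Then the iterated saturations $\widehat D_E^{k}(F_1)$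 and $\widehat{(D^*)}_{E^*}^{k}(G_1)$, $1\le k\le 2m$, exist; $\mathbb F$ and $\mathcal S$ are holomorphic subbundles of $E$; the natural homomorphism $\mathbb F\oplus\mathcal S\to E$ is an isomorphism of holomorphic vector bundles; and the resulting decomposition $E=\mathbb F\oplus\mathcal S$ is orthogonal with respect to $B_0$. -/

import Mathlib

open Bundle
open scoped Manifold ContDiff Topology

noncomputable section

namespace SOQuasioper

section Bundles

/-! Throughout, `X` is a complex one-dimensional manifold (charts in `ℂ`, analytic transition maps)
and `E` is a holomorphic vector bundle over `X` with model fibre `F`. "Holomorphic" is spelled as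
`C^ω` over `ℂ`. A local section over `U` is a section `s : Π x, E x` of which only the values on `U`
matter. -/

variable {X : Type*} [TopologicalSpace X] [ChartedSpace ℂ X]
  (F : Type*) [NormedAddCommGroup F] [NormedSpace ℂ F]
  {E : X → Type*} [TopologicalSpace (TotalSpace F E)]
  [∀ x, AddCommGroup (E x)] [∀ x, Module ℂ (E x)] [∀ x, TopologicalSpace (E x)]
  [∀ x, IsTopologicalAddGroup (E x)] [∀ x, ContinuousSMul ℂ (E x)]
  [FiberBundle F E]

/-- `s` is a holomorphic section of `E` over `U`. -/
def IsHolSection (U : Set X) (s : Π x, E x) : Prop :=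
  ContMDiffOn 𝓘(ℂ) (𝓘(ℂ).prod 𝓘(ℂ, F)) ω (fun x ↦ TotalSpace.mk' F x (s x)) U

/-- A family of subspaces of the fibres is a holomorphic subbundle if, locally on `X`, it has
a holomorphic frame. -/
def IsHolSubbundle (V : Π x, Submodule ℂ (E x)) : Prop :=
  ∀ x₀ : X, ∃ U : Set X, IsOpen U ∧ x₀ ∈ U ∧ ∃ (k : ℕ) (s : Fin k → Π x, E x),
    (∀ i, IsHolSection F U (s i)) ∧
    ∀ x ∈ U, LinearIndependent ℂ (fun i ↦ s i x) ∧
      Submodule.span ℂ (Set.range fun i ↦ s i x) = V x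

/-- `D` takes `V` into `W ⊗ K_X`: for every holomorphic section `s` of `V` over an open set `U`,
the `1`-form `D s` takes values in `W` on `U`. -/
def MapsInto (D : CovariantDerivative 𝓘(ℂ) F E) (V W : Π x, Submodule ℂ (E x)) : Prop :=
  ∀ (U : Set X) (s : Π x, E x), IsOpen U → IsHolSection F U s → (∀ x ∈ U, s x ∈ V x) →
    ∀ x ∈ U, ∀ v : TangentSpace 𝓘(ℂ) x, D s x v ∈ W x

/-- The holomorphic subbundles `W ⊇ V` such that `D` takes `V` into `W ⊗ K_X`. -/
def saturations (D : CovariantDerivative 𝓘(ℂ) F E) (V : Π x, Submodule ℂ (E x)) :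
    Set (Π x, Submodule ℂ (E x)) :=
  {W | IsHolSubbundle F W ∧ V ≤ W ∧ MapsInto F D V W}

/-- The minimal `D`-saturation of `V`, the smallest holomorphic subbundle `W ⊇ V` such that
`D` takes `V` into `W ⊗ K_X`. It is written as the fibrewise intersection of all of these
subbundles, which is the smallest one of them as soon as it is a holomorphic subbundle
(see `isLeast_saturation`). -/
def saturation (D : CovariantDerivative 𝓘(ℂ) F E) (V : Π x, Submodule ℂ (E x)) :
    Π x, Submodule ℂ (E x) :=
  sInf (saturations F D V)

theorem isLeast_saturation (D : CovariantDerivative 𝓘(ℂ) F E) (V : Π x, Submodule ℂ (E x))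
    (h : IsHolSubbundle F (saturation F D V)) :
    IsLeast (saturations F D V) (saturation F D V) := by
  refine ⟨⟨h, le_sInf fun W hW ↦ hW.2.1, ?_⟩, fun W hW ↦ sInf_le hW⟩
  intro U s hU hs hsV x hx v
  simp only [saturation, sInf_apply, Submodule.mem_iInf]
  exact fun W ↦ W.2.2.2 U s hU hs hsV x hx v

/-- Conversely, a least element of `saturations` is the saturation. -/
theorem saturation_eq_of_isLeast (D : CovariantDerivative 𝓘(ℂ) F E)
    (V W : Π x, Submodule ℂ (E x)) (h : IsLeast (saturations F D V) W) :
    saturation F D V = W :=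
  h.isGLB.sInf_eq

/-- The iterated saturation `D̂^k(V)`. -/
def iterSaturation (D : CovariantDerivative 𝓘(ℂ) F E) (k : ℕ) (V : Π x, Submodule ℂ (E x)) :
    Π x, Submodule ℂ (E x) :=
  (saturation F D)^[k] V

/-- `D` is a holomorphic connection: it takes holomorphic sections of `E` over an open set to
holomorphic sections of `E ⊗ K_X = Hom(TX, E)`. (Additivity and the Leibniz identity are part of
`CovariantDerivative`.) -/
def IsHolConnection [IsManifold 𝓘(ℂ) 1 X] [VectorBundle ℂ F E]
    (D : CovariantDerivative 𝓘(ℂ) F E) : Prop :=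
  ∀ U : Set X, IsOpen U → ContMDiffCovariantDerivativeOn F ω D U

/-- The quotient `V / W` of two subspaces `W ⊆ V` of a vector space. -/
abbrev quot {A : Type*} [AddCommGroup A] [Module ℂ A] (V W : Submodule ℂ A) : Type _ :=
  ↥V ⧸ W.submoduleOf V

/-- `φ` is the fibre at `x` of the second fundamental form
`F₂ / F₁ → (F₄ / F₃) ⊗ K_X = Hom(TX, F₄ / F₃)`: it sends the class of `s x` to the class of
`D s` at `x`, for all local holomorphic sections `s` of `F₂`. As every vector of `F₂ x` is the value
of such an `s`, there is at most one such `φ`. -/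
def IsSecondFundamentalForm (D : CovariantDerivative 𝓘(ℂ) F E)
    (F₁ F₂ F₃ F₄ : Π x, Submodule ℂ (E x)) (x : X)
    (φ : quot (F₂ x) (F₁ x) →ₗ[ℂ] TangentSpace 𝓘(ℂ) x →ₗ[ℂ] quot (F₄ x) (F₃ x)) : Prop :=
  ∀ (U : Set X) (s : Π y, E y) (hx : x ∈ U), IsOpen U → IsHolSection F U s →
    ∀ (hs : ∀ y ∈ U, s y ∈ F₂ y) (v : TangentSpace 𝓘(ℂ) x),
      ∃ h : D s x v ∈ F₄ x,
        φ (Submodule.Quotient.mk ⟨s x, hs x hx⟩) v = Submodule.Quotient.mk ⟨D s x v, h⟩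

/-- `E` is, as a holomorphic vector bundle, the direct sum of its subbundles `P` and `Q`: the natural
homomorphism `P ⊕ Q → E` is bijective on each fibre and on holomorphic sections over each open
set. -/
structure IsHolDirectSum (P Q : Π x, Submodule ℂ (E x)) : Prop where
  subbundle_left : IsHolSubbundle F P
  subbundle_right : IsHolSubbundle F Q
  bijective : ∀ x, Function.Bijective ((P x).subtype.coprod (Q x).subtype)
  sections : ∀ (U : Set X) (s : Π x, E x), IsOpen U → IsHolSection F U s →
    ∃ a b : Π x, E x, IsHolSection F U a ∧ IsHolSection F U b ∧
      ∀ x ∈ U, a x ∈ P x ∧ b x ∈ Q x ∧ a x + b x = s x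

end Bundles

section Dual

variable {X : Type*} [TopologicalSpace X] [ChartedSpace ℂ X]
  {F : Type*} [NormedAddCommGroup F] [NormedSpace ℂ F]
  {E : X → Type*} [TopologicalSpace (TotalSpace F E)]
  [∀ x, AddCommGroup (E x)] [∀ x, Module ℂ (E x)] [∀ x, TopologicalSpace (E x)]
  [∀ x, IsTopologicalAddGroup (E x)] [∀ x, ContinuousSMul ℂ (E x)]
  [FiberBundle F E] [VectorBundle ℂ F E]

/-- The dual bundle `E*`, with model fibre `F →L[ℂ] ℂ`. -/
abbrev DualBundle (E : X → Type*) [∀ x, AddCommGroup (E x)] [∀ x, Module ℂ (E x)]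
    [∀ x, TopologicalSpace (E x)] : X → Type _ :=
  fun x ↦ E x →L[ℂ] Bundle.Trivial X ℂ x

/-- The natural pairing of a section of `E*` with a section of `E`. -/
def pairing (φ : Π x, DualBundle E x) (s : Π x, E x) : X → ℂ :=
  fun x ↦ φ x (s x)

theorem mdifferentiableAt_pairing {φ : Π x, DualBundle E x} {s : Π x, E x} {x : X}
    (hφ : MDiffAt (fun y ↦ TotalSpace.mk' (F →L[ℂ] ℂ) (E := DualBundle E) y (φ y)) x)
    (hs : MDiffAt (T% s) x) :
    MDiffAt (pairing φ s) x := by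
  have h := MDifferentiableAt.clm_bundle_apply (F₁ := F) (F₂ := ℂ) (E₂ := Bundle.Trivial X ℂ)
    (b := fun y : X ↦ y) (ϕ := φ) (v := s) hφ hs
  rw [mdifferentiableAt_totalSpace] at h
  exact h.2

/-- For a section `φ` of `E*`, the operation `s ↦ d(φ(s)) - φ(D s)` at `x`. -/
def dualConnectionAux (D : CovariantDerivative 𝓘(ℂ) F E) (φ : Π x, DualBundle E x) (x : X)
    (s : Π x, E x) : TangentSpace 𝓘(ℂ) x →L[ℂ] ℂ :=
  mvfderiv 𝓘(ℂ) (pairing φ s) x - (φ x : E x →L[ℂ] ℂ) ∘L D s x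

theorem tensorialAt_dualConnectionAux (D : CovariantDerivative 𝓘(ℂ) F E)
    (φ : Π x, DualBundle E x) (x : X)
    (hφ : MDiffAt (fun y ↦ TotalSpace.mk' (F →L[ℂ] ℂ) (E := DualBundle E) y (φ y)) x)
    (v : TangentSpace 𝓘(ℂ) x) :
    TensorialAt 𝓘(ℂ) F (fun s ↦ dualConnectionAux D φ x s v) x where
  smul {f s} hf hs := by
    have h1 : pairing φ (f • s) = f * pairing φ s := by
      ext y; simp [pairing]
    simp only [dualConnectionAux, h1, mvfderiv_mul hf (mdifferentiableAt_pairing hφ hs),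
      D.isCovariantDerivativeOnUniv.leibniz hs hf]
    simp [pairing]
    ring
  add {s s'} hs hs' := by
    have h1 : pairing φ (s + s') = pairing φ s + pairing φ s' := by
      ext y; simp [pairing]
    simp only [dualConnectionAux, h1, mvfderiv_add (mdifferentiableAt_pairing hφ hs)
      (mdifferentiableAt_pairing hφ hs'), D.isCovariantDerivativeOnUniv.add hs hs']
    simp
    ring

variable [FiniteDimensional ℂ F] [ContMDiffVectorBundle 1 F E 𝓘(ℂ)]

open Classical in
/-- The underlying function of the connection `D*` on `E*` induced by `D`: at a point `x` where the
section `φ` is differentiable, `(D* φ)(s) = d(φ(s)) - φ(D s)` (see `dualConnection_apply`). -/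
def dualConnectionFun (D : CovariantDerivative 𝓘(ℂ) F E) (φ : Π x, DualBundle E x) (x : X) :
    TangentSpace 𝓘(ℂ) x →L[ℂ] DualBundle E x :=
  if hφ : MDiffAt (fun y ↦ TotalSpace.mk' (F →L[ℂ] ℂ) (E := DualBundle E) y (φ y)) x then
    haveI : T2Space (TangentSpace 𝓘(ℂ) x) := inferInstanceAs (T2Space ℂ)
    haveI : FiniteDimensional ℂ (TangentSpace 𝓘(ℂ) x) := inferInstanceAs (FiniteDimensional ℂ ℂ)
    LinearMap.toContinuousLinearMap
      { toFun := fun v ↦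
          TensorialAt.mkHom (A := ℂ) (fun s ↦ dualConnectionAux D φ x s v) x
            (tensorialAt_dualConnectionAux D φ x hφ v)
        map_add' := fun v w ↦ by
          ext e
          simp only [TensorialAt.mkHom_apply_eq_extend, add_apply]
          exact map_add _ v w
        map_smul' := fun c v ↦ by
          ext e
          simp only [TensorialAt.mkHom_apply_eq_extend, smul_apply]
          exact map_smul _ c v }
  else 0

theorem dualConnectionFun_apply (D : CovariantDerivative 𝓘(ℂ) F E) {φ : Π x, DualBundle E x}
    {s : Π x, E x} {x : X}
    (hφ : MDiffAt (fun y ↦ TotalSpace.mk' (F →L[ℂ] ℂ) (E := DualBundle E) y (φ y)) x)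
    (hs : MDiffAt (T% s) x) (v : TangentSpace 𝓘(ℂ) x) :
    dualConnectionFun D φ x v (s x) = mvfderiv 𝓘(ℂ) (pairing φ s) x v - φ x (D s x v) := by
  rw [dualConnectionFun, dif_pos hφ]
  exact TensorialAt.mkHom_apply (tensorialAt_dualConnectionAux D φ x hφ v) hs

/-- The connection `D*` on the dual bundle `E*` induced by a connection `D` on `E`. -/
def dualConnection (D : CovariantDerivative 𝓘(ℂ) F E) :
    CovariantDerivative 𝓘(ℂ) (F →L[ℂ] ℂ) (DualBundle E) where
  toFun := dualConnectionFun D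
  isCovariantDerivativeOnUniv :=
    { add := by
        intro φ ψ x hφ hψ _
        refine ContinuousLinearMap.ext fun v ↦ ContinuousLinearMap.ext fun e ↦ ?_
        have hs : MDiffAt (T% (FiberBundle.extend F e)) x :=
          FiberBundle.mdifferentiableAt_extend ..
        have he : FiberBundle.extend F e x = e := by simp
        have h1 : pairing (φ + ψ) (FiberBundle.extend F e) =
            pairing φ (FiberBundle.extend F e) + pairing ψ (FiberBundle.extend F e) := by
          ext y; simp [pairing]
        have hφψ : MDiffAt (fun y ↦ TotalSpace.mk' (F →L[ℂ] ℂ) (E := DualBundle E) y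
            ((φ + ψ) y)) x := mdifferentiableAt_add_section hφ hψ
        rw [← he]
        simp only [add_apply]
        rw [dualConnectionFun_apply D hφψ hs, dualConnectionFun_apply D hφ hs,
          dualConnectionFun_apply D hψ hs, h1,
          mvfderiv_add (mdifferentiableAt_pairing hφ hs) (mdifferentiableAt_pairing hψ hs)]
        simp
        ring
      leibniz := by
        intro φ g x hφ hg _
        refine ContinuousLinearMap.ext fun v ↦ ContinuousLinearMap.ext fun e ↦ ?_
        have hs : MDiffAt (T% (FiberBundle.extend F e)) x :=
          FiberBundle.mdifferentiableAt_extend ..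
        have he : FiberBundle.extend F e x = e := by simp
        change dualConnectionFun D (fun y ↦ g y • φ y) x v e = _
        have h1 : pairing (fun y ↦ g y • φ y) (FiberBundle.extend F e) =
            g * pairing φ (FiberBundle.extend F e) := by
          ext y; simp [pairing]
        have hgφ : MDiffAt (fun y ↦ TotalSpace.mk' (F →L[ℂ] ℂ) (E := DualBundle E) y
            (g y • φ y)) x := MDifferentiableAt.smul_section hg hφ
        rw [← he]
        simp only [add_apply, smul_apply]
        rw [dualConnectionFun_apply D hgφ hs, dualConnectionFun_apply D hφ hs, h1,
          mvfderiv_mul hg (mdifferentiableAt_pairing hφ hs)]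
        simp [pairing]
        ring }

/-- The defining property of the dual connection: `d(φ(s)) = (D* φ)(s) + φ(D s)`. -/
theorem dualConnection_apply (D : CovariantDerivative 𝓘(ℂ) F E) {φ : Π x, DualBundle E x}
    {s : Π x, E x} {x : X}
    (hφ : MDiffAt (fun y ↦ TotalSpace.mk' (F →L[ℂ] ℂ) (E := DualBundle E) y (φ y)) x)
    (hs : MDiffAt (T% s) x) (v : TangentSpace 𝓘(ℂ) x) :
    dualConnection D φ x v (s x) = mvfderiv 𝓘(ℂ) (pairing φ s) x v - φ x (D s x v) :=
  dualConnectionFun_apply D hφ hs v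

end Dual

section Quasioper

variable {X : Type*} [TopologicalSpace X] [ChartedSpace ℂ X] [IsManifold 𝓘(ℂ) ω X]
  (F : Type*) [NormedAddCommGroup F] [NormedSpace ℂ F] [FiniteDimensional ℂ F]
  (E : X → Type*) [TopologicalSpace (TotalSpace F E)]
  [∀ x, AddCommGroup (E x)] [∀ x, Module ℂ (E x)] [∀ x, TopologicalSpace (E x)]
  [∀ x, IsTopologicalAddGroup (E x)] [∀ x, ContinuousSMul ℂ (E x)]
  [FiberBundle F E] [VectorBundle ℂ F E] [ContMDiffVectorBundle ω F E 𝓘(ℂ)]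

variable {E} in
/-- `E` has rank `2n`, its determinant is trivial, and `B` is an `SO(2n, ℂ)` structure on `E`. -/
structure IsSOStructure (n : ℕ) (B : Π x, E x →L[ℂ] E x →L[ℂ] ℂ) : Prop where
  rank_eq : Module.finrank ℂ F = 2 * n
  /-- `det E` is holomorphically trivial: there is a nowhere vanishing holomorphic section of the
  dual line bundle of `⋀^{2n} E`. -/
  det_trivial : ∃ vol : Π x, E x [⋀^Fin (2 * n)]→ₗ[ℂ] ℂ, (∀ x, vol x ≠ 0) ∧
    ∀ (U : Set X) (s : Fin (2 * n) → Π x, E x), IsOpen U → (∀ i, IsHolSection F U (s i)) →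
      ContMDiffOn 𝓘(ℂ) 𝓘(ℂ) ω (fun x ↦ vol x fun i ↦ s i x) U
  holomorphic : ContMDiff 𝓘(ℂ) (𝓘(ℂ).prod 𝓘(ℂ, F →L[ℂ] F →L[ℂ] ℂ)) ω
    (fun x ↦ TotalSpace.mk' (F →L[ℂ] F →L[ℂ] ℂ)
      (E := fun x ↦ E x →L[ℂ] E x →L[ℂ] Bundle.Trivial X ℂ x) x (B x))
  symm : ∀ x (e f : E x), B x e f = B x f e
  nondegenerate : ∀ x (e : E x), (∀ f : E x, B x f e = 0) → e = 0

variable {E} in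
/-- `0 = Fil 0 ⊆ Fil 1 ⊆ ⋯ ⊆ Fil (2m+1) = E` is a filtration of the `SO(2n, ℂ)`-bundle `(E, B)`
of length `2m+1`. The values `Fil i` for `i > 2m+1` play no role. -/
structure IsFiltration (B : Π x, E x →L[ℂ] E x →L[ℂ] ℂ) (m : ℕ)
    (Fil : ℕ → Π x, Submodule ℂ (E x)) : Prop where
  subbundle : ∀ i ≤ 2 * m + 1, IsHolSubbundle F (Fil i)
  zero : ∀ x, Fil 0 x = ⊥
  top : ∀ x, Fil (2 * m + 1) x = ⊤
  mono : ∀ i ≤ 2 * m, ∀ x, Fil i x ≤ Fil (i + 1) x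
  rank_middle : ∀ x, Module.finrank ℂ (quot (Fil (m + 1) x) (Fil m x)) =
    2 * Module.finrank ℂ (Fil 1 x)
  rank_other : ∀ i ≤ 2 * m, i ≠ m → ∀ x,
    Module.finrank ℂ (quot (Fil (i + 1) x) (Fil i x)) = Module.finrank ℂ (Fil 1 x)
  perp : ∀ i ≤ m, ∀ x (e : E x), (∀ f ∈ Fil i x, B x f e = 0) ↔ e ∈ Fil (2 * m + 1 - i) x

variable {E} in
/-- `D` is a holomorphic connection on the filtered `SO(2n, ℂ)`-bundle `(E, B, Fil)`. -/
structure IsFilteredConnection (B : Π x, E x →L[ℂ] E x →L[ℂ] ℂ) (m : ℕ)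
    (Fil : ℕ → Π x, Submodule ℂ (E x)) (D : CovariantDerivative 𝓘(ℂ) F E) : Prop where
  holomorphic : IsHolConnection F D
  /-- `D` preserves `B`. -/
  compatible : ∀ (U : Set X) (s t : Π x, E x), IsOpen U → IsHolSection F U s →
    IsHolSection F U t → ∀ x ∈ U, ∀ v : TangentSpace 𝓘(ℂ) x,
      mvfderiv 𝓘(ℂ) (fun y ↦ B y (s y) (t y)) x v = B x (D s x v) (t x) + B x (s x) (D t x v)
  mapsInto : ∀ i, 1 ≤ i → i ≤ 2 * m → MapsInto F D (Fil i) (Fil (i + 1))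
  /-- The second fundamental form `S(D, i) : F_i / F_{i-1} → (F_{i+1} / F_i) ⊗ K_X` is an
  isomorphism for `i ≠ m, m + 1`. -/
  second_iso : ∀ i, 1 ≤ i → i ≤ 2 * m → i ≠ m → i ≠ m + 1 → ∀ x,
    ∃ φ : quot (Fil i x) (Fil (i - 1) x) →ₗ[ℂ]
        TangentSpace 𝓘(ℂ) x →ₗ[ℂ] quot (Fil (i + 1) x) (Fil i x),
      IsSecondFundamentalForm F D (Fil (i - 1)) (Fil i) (Fil i) (Fil (i + 1)) x φ ∧
        Function.Bijective φ
  /-- The composition of `S(D, m)` and `S(D, m + 1) ⊗ Id`, from `F_m / F_{m-1}` to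
  `(F_{m+2} / F_{m+1}) ⊗ K_X ⊗ K_X = Hom(TX, Hom(TX, F_{m+2} / F_{m+1}))`, is an isomorphism. -/
  second_comp_iso : ∀ x,
    ∃ (φ : quot (Fil m x) (Fil (m - 1) x) →ₗ[ℂ]
        TangentSpace 𝓘(ℂ) x →ₗ[ℂ] quot (Fil (m + 1) x) (Fil m x))
      (ψ : quot (Fil (m + 1) x) (Fil m x) →ₗ[ℂ]
        TangentSpace 𝓘(ℂ) x →ₗ[ℂ] quot (Fil (m + 2) x) (Fil (m + 1) x)),
      IsSecondFundamentalForm F D (Fil (m - 1)) (Fil m) (Fil m) (Fil (m + 1)) x φ ∧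
      IsSecondFundamentalForm F D (Fil m) (Fil (m + 1)) (Fil (m + 1)) (Fil (m + 2)) x ψ ∧
      Function.Bijective fun e ↦ ψ ∘ₗ φ e

/-- Generalized `SO(2n, ℂ)`-quasiopers with underlying holomorphic vector bundle `E` and with
filtration of length `2m+1`. -/
structure GeneralizedQuasioper (n m : ℕ) where
  /-- The bilinear form `B₀`. -/
  B : Π x, E x →L[ℂ] E x →L[ℂ] ℂ
  /-- The filtration. -/
  Fil : ℕ → Π x, Submodule ℂ (E x)
  /-- The connection. -/
  D : CovariantDerivative 𝓘(ℂ) F E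
  isSOStructure : IsSOStructure F n B
  isFiltration : IsFiltration F B m Fil
  isFilteredConnection : IsFilteredConnection F B m Fil D

namespace GeneralizedQuasioper

variable {F E} {n m : ℕ}

/-- The subbundle `𝔽 = D̂^{2m}(F₁)` of `E`. -/
def bundleF (Q : GeneralizedQuasioper F E n m) : Π x, Submodule ℂ (E x) :=
  iterSaturation F Q.D (2 * m) (Q.Fil 1)

/-- The connection `D*` on `E*`. -/
def dualD (Q : GeneralizedQuasioper F E n m) :
    CovariantDerivative 𝓘(ℂ) (F →L[ℂ] ℂ) (DualBundle E) :=
  dualConnection Q.D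

/-- The filtration of the dual quasioper: `G_j` is the kernel of the restriction map
`E* → (F_{2m+1-j})*`. -/
def dualFil (Q : GeneralizedQuasioper F E n m) (j : ℕ) (x : X) : Submodule ℂ (DualBundle E x) :=
  LinearMap.ker ((Q.Fil (2 * m + 1 - j) x).subtype.dualMap ∘ₗ
    (ContinuousLinearMap.coeLM ℂ : (E x →L[ℂ] ℂ) →ₗ[ℂ] E x →ₗ[ℂ] ℂ))

/-- The subbundle `𝔾 = (D̂*)^{2m}(G₁)` of `E*`. -/
def bundleG (Q : GeneralizedQuasioper F E n m) : Π x, Submodule ℂ (DualBundle E x) :=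
  iterSaturation (F →L[ℂ] ℂ) Q.dualD (2 * m) (Q.dualFil 1)

/-- The subbundle `𝒮 = (E* / 𝔾)*` of `E** = E`: the vectors of `E` whose evaluation on `E*` lies in
the image of the dual `(E* / 𝔾)* → E**` of the quotient map `E* → E* / 𝔾`. -/
def bundleS (Q : GeneralizedQuasioper F E n m) (x : X) : Submodule ℂ (E x) :=
  Submodule.comap
    (ContinuousLinearMap.coeLM ℂ : (E x →L[ℂ] ℂ) →ₗ[ℂ] E x →ₗ[ℂ] ℂ).flip
    (LinearMap.range (Q.bundleG x).mkQ.dualMap)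

end GeneralizedQuasioper

end Quasioper

end SOQuasioper

end

/-! Near a point take a holomorphic frame `e 0 i` of F₁ and a nowhere vanishing vector field w, and
differentiate repeatedly: `e (j+1) i = D_w (e j i)`. Then `e j i` lies in F_{j+1}, so `F_i^⊥ =
F_{2m+1-i}` makes B(e j, e k) vanish for j + k < 2m (`IsTower.B_eq_zero`). Differentiating these
relations for j + k = 2m - 1 gives B(e (j+1), e k) = -B(e j, e (k+1)) (`IsTower.B_succ`). The Gram
matrix of the family j ≤ 2m is therefore block antitriangular, with antidiagonal blocks ±B(e 0, e
(2m)).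

The second fundamental forms show that the `e (2m) i` generate E / F_{2m} (`IsTower.fil_le`). Since
F_{2m} = F₁^⊥, the block B(e 0, e (2m)) is nondegenerate, and hence so is the whole Gram matrix
(`IsTower.coeff_eq_zero`). Thus the `e j i` are independent. The k-th saturation of F₁ is spanned by
those with j ≤ k (`iterSaturation_eq_frameSpan`), and B is nondegenerate on 𝔽.

As B is parallel, it carries D to D* (`dualD_flat`) and F₁ to G₁, so the same argument on E* gives 𝔾
= B(𝔽). Its annihilator 𝒮 is then 𝔽^⊥, and E = 𝔽 ⊕ 𝔽^⊥. The projection to 𝔽 solves a linear system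
with the Gram matrix, so Cramer's rule makes it holomorphic. -/

noncomputable section

namespace SOQuasioper

/-! ### Linear systems with holomorphic coefficients. -/

section Cramer

variable {X : Type*} [TopologicalSpace X] [ChartedSpace ℂ X] {ι : Type*} [Fintype ι] {x₀ : X}

theorem contMDiffAt_det [DecidableEq ι] {A : X → Matrix ι ι ℂ}
    (hA : ∀ i j, ContMDiffAt 𝓘(ℂ) 𝓘(ℂ) ω (fun x ↦ A x i j) x₀) :
    ContMDiffAt 𝓘(ℂ) 𝓘(ℂ) ω (fun x ↦ (A x).det) x₀ := by
  simp only [Matrix.det_apply']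
  exact contMDiffAt_finsetSum fun σ _ ↦
    contMDiffAt_const.mul (contMDiffAt_finsetProd fun i _ ↦ hA _ _)

/-- The solution of a nondegenerate linear system with holomorphic coefficients is holomorphic. -/
theorem contMDiffAt_of_mulVec_eq [DecidableEq ι] {A : X → Matrix ι ι ℂ} {b c : X → ι → ℂ}
    (hA : ∀ i j, ContMDiffAt 𝓘(ℂ) 𝓘(ℂ) ω (fun x ↦ A x i j) x₀)
    (hb : ∀ i, ContMDiffAt 𝓘(ℂ) 𝓘(ℂ) ω (fun x ↦ b x i) x₀)
    (hdet : (A x₀).det ≠ 0) (h : ∀ᶠ x in 𝓝 x₀, (A x).mulVec (c x) = b x) (i : ι) :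
    ContMDiffAt 𝓘(ℂ) 𝓘(ℂ) ω (fun x ↦ c x i) x₀ := by
  have hd := contMDiffAt_det hA
  -- No regularity of `c` is assumed. Cramer's rule writes `c x i` as this determinant divided by
  -- `(A x).det`.
  have hcr : ContMDiffAt 𝓘(ℂ) 𝓘(ℂ) ω (fun x ↦ ((A x).updateCol i (b x)).det) x₀ := by
    refine contMDiffAt_det fun k j ↦ ?_
    by_cases hj : j = i
    · subst hj
      simpa using hb k
    · simpa [Matrix.updateCol_apply, hj] using hA k j
  refine ((hd.inv₀ hdet).mul hcr).congr_of_eventuallyEq ?_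
  filter_upwards [h, hd.continuousAt.eventually_ne hdet] with x hx hx'
  have h1 : (A x).cramer (b x) = (A x).det • c x := by
    rw [Matrix.cramer_eq_adjugate_mulVec, ← hx, Matrix.mulVec_mulVec, Matrix.adjugate_mul,
      Matrix.smul_mulVec, Matrix.one_mulVec]
  have h2 := congrFun h1 i
  rw [Matrix.cramer_apply] at h2
  simp only [Pi.mul_apply, h2, Pi.smul_apply, smul_eq_mul]
  field_simp

end Cramer

section LinearAlgebra

/-- A left inverse of the injection K^ι → A defined by `g` has the required functionals as its
coordinates. -/
theorem exists_dual_family {K A ι : Type*} [Field K] [AddCommGroup A] [Module K A]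
    [Fintype ι] [DecidableEq ι] {g : ι → A} (hg : LinearIndependent K g) :
    ∃ L : ι → A →ₗ[K] K, ∀ i j, L i (g j) = if i = j then 1 else 0 := by
  obtain ⟨L, hL⟩ := (Fintype.linearCombination K g).exists_leftInverse_of_injective
    (LinearMap.ker_eq_bot.2 hg.fintypeLinearCombination_injective)
  refine ⟨fun i ↦ LinearMap.proj i ∘ₗ L, fun i j ↦ ?_⟩
  have h := LinearMap.congr_fun hL (Pi.single j 1)
  simp only [LinearMap.comp_apply, Fintype.linearCombination_apply_single, one_smul,
    LinearMap.id_apply] at h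
  simp [h, Pi.single_apply]

theorem mem_span_range_iff_exists_sum {K A ι : Type*} [Field K] [AddCommGroup A] [Module K A]
    [Fintype ι] {g : ι → A} {a : A} :
    a ∈ Submodule.span K (Set.range g) ↔ ∃ c : ι → K, ∑ i, c i • g i = a :=
  Submodule.mem_span_range_iff_exists_fun K

end LinearAlgebra

/-! ### Local holomorphic sections, frames, and their covariant derivatives. -/

section Sections

variable {X : Type*} [TopologicalSpace X] [ChartedSpace ℂ X]
  {F : Type*} [NormedAddCommGroup F] [NormedSpace ℂ F]
  {E : X → Type*} [TopologicalSpace (TotalSpace F E)]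
  [∀ x, TopologicalSpace (E x)] [FiberBundle F E]

theorem IsHolSection.mono {U V : Set X} {s : Π x, E x} (hs : IsHolSection F U s) (h : V ⊆ U) :
    IsHolSection F V s :=
  ContMDiffOn.mono hs h

theorem IsHolSection.congr {U : Set X} {s t : Π x, E x} (hs : IsHolSection F U s)
    (h : ∀ x ∈ U, t x = s x) : IsHolSection F U t :=
  ContMDiffOn.congr hs fun x hx ↦ by simp only [h x hx]

theorem IsHolSection.contMDiffAt {U : Set X} {s : Π x, E x} (hs : IsHolSection F U s)
    (hU : IsOpen U) {x : X} (hx : x ∈ U) : CMDiffAt ω (T% s) x :=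
  ContMDiffOn.contMDiffAt hs (hU.mem_nhds hx)

theorem IsHolSection.mdifferentiableAt {U : Set X} {s : Π x, E x} (hs : IsHolSection F U s)
    (hU : IsOpen U) {x : X} (hx : x ∈ U) : MDiffAt (T% s) x :=
  (hs.contMDiffAt hU hx).mdifferentiableAt (by simp)

variable [∀ x, AddCommGroup (E x)] [∀ x, Module ℂ (E x)] [VectorBundle ℂ F E]

omit [ChartedSpace ℂ X] in
theorem linearMapAt_apply_of_mem (τ : Trivialization F (TotalSpace.proj : TotalSpace F E → X))
    [MemTrivializationAtlas τ] {x : X} (hx : x ∈ τ.baseSet) (a : E x) :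
    τ.linearMapAt ℂ x a = (τ ⟨x, a⟩).2 :=
  congrFun (τ.coe_linearMapAt_of_mem hx) a

omit [ChartedSpace ℂ X] in
theorem ker_linearMapAt (τ : Trivialization F (TotalSpace.proj : TotalSpace F E → X))
    [MemTrivializationAtlas τ] {x : X} (hx : x ∈ τ.baseSet) :
    LinearMap.ker (τ.linearMapAt ℂ x) = ⊥ :=
  LinearMap.ker_eq_bot.2 (Function.LeftInverse.injective (τ.symmₗ_linearMapAt hx))

theorem IsHolSection.sum_smul {ι : Type*} [Fintype ι] {U : Set X} {c : X → ι → ℂ}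
    {e : ι → Π x, E x} (hc : ∀ i, ContMDiffOn 𝓘(ℂ) 𝓘(ℂ) ω (fun x ↦ c x i) U)
    (he : ∀ i, IsHolSection F U (e i)) :
    IsHolSection F U (fun x ↦ ∑ i, c x i • e i x) :=
  ContMDiffOn.sum_section fun i _ ↦ (hc i).smul_section (he i)

/-- Every vector of a fibre extends to a holomorphic section near its base point. -/
theorem exists_isHolSection_eq [ContMDiffVectorBundle ω F E 𝓘(ℂ)] {x₀ : X} (a : E x₀) :
    ∃ (U : Set X) (s : Π x, E x), IsOpen U ∧ x₀ ∈ U ∧ IsHolSection F U s ∧ s x₀ = a ∧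
      (a ≠ 0 → ∀ x ∈ U, s x ≠ 0) := by
  let τ := trivializationAt F E x₀
  have hx₀ : x₀ ∈ τ.baseSet := FiberBundle.mem_baseSet_trivializationAt' x₀
  -- The extension has constant coordinates in the trivialization, so it vanishes nowhere if `a ≠
  -- 0`.
  refine ⟨τ.baseSet, fun x ↦ τ.symm x (τ ⟨x₀, a⟩).2, τ.open_baseSet, hx₀, ?_, ?_, ?_⟩
  · rw [IsHolSection, τ.contMDiffOn_section_baseSet_iff]
    refine (contMDiffOn_const (c := (τ ⟨x₀, a⟩).2)).congr fun y hy ↦ ?_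
    rw [τ.apply_mk_symm hy]
  · exact τ.symm_apply_apply_mk hx₀ a
  · intro ha x hx h0
    have h1 : (τ ⟨x, τ.symm x (τ ⟨x₀, a⟩).2⟩).2 = (τ ⟨x₀, a⟩).2 := by rw [τ.apply_mk_symm hx]
    rw [show τ.symm x (τ ⟨x₀, a⟩).2 = 0 from h0] at h1
    have h2 : (τ ⟨x, (0 : E x)⟩).2 = 0 := (τ.linear ℂ hx).map_zero
    have h3 : (τ ⟨x₀, (0 : E x₀)⟩).2 = 0 := (τ.linear ℂ hx₀).map_zero
    apply ha
    rw [← τ.symm_apply_apply_mk hx₀ a, ← h1, h2, ← h3, τ.symm_apply_apply_mk hx₀]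

/-- The coordinates of a holomorphic section in a holomorphic frame of a subbundle are
holomorphic. -/
theorem IsHolSection.contMDiffAt_coeff [FiniteDimensional ℂ F] {ι : Type*} [Fintype ι]
    {U : Set X} (hU : IsOpen U)
    {e : ι → Π x, E x} (he : ∀ i, IsHolSection F U (e i)) {x₀ : X} (hx₀ : x₀ ∈ U)
    (hli : LinearIndependent ℂ fun i ↦ e i x₀) {s : Π x, E x} (hs : IsHolSection F U s)
    {c : X → ι → ℂ} (hc : ∀ x ∈ U, ∑ i, c x i • e i x = s x) (i : ι) :
    ContMDiffAt 𝓘(ℂ) 𝓘(ℂ) ω (fun x ↦ c x i) x₀ := by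
  classical
  let τ := trivializationAt F E x₀
  have hτ : x₀ ∈ τ.baseSet := FiberBundle.mem_baseSet_trivializationAt' x₀
  have hcoord {t : Π x, E x} (ht : IsHolSection F U t) :
      ContMDiffAt 𝓘(ℂ) 𝓘(ℂ, F) ω (fun x ↦ τ.linearMapAt ℂ x (t x)) x₀ := by
    have h1 := (contMDiffAt_section x₀).1 (ht.contMDiffAt hU hx₀)
    refine h1.congr_of_eventuallyEq ?_
    filter_upwards [τ.open_baseSet.mem_nhds hτ] with x hx
    exact linearMapAt_apply_of_mem τ hx _
  have hli' : LinearIndependent ℂ fun i ↦ τ.linearMapAt ℂ x₀ (e i x₀) := by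
    exact hli.map' (τ.linearMapAt ℂ x₀) (ker_linearMapAt τ hτ)
  -- Fixed functionals dual to the frame at `x₀` turn the vector equation into a square system whose
  -- matrix at `x₀` is the identity.
  obtain ⟨L, hL⟩ := exists_dual_family hli'
  have hLsm {t : Π x, E x} (ht : IsHolSection F U t) (i : ι) :
      ContMDiffAt 𝓘(ℂ) 𝓘(ℂ) ω (fun x ↦ L i (τ.linearMapAt ℂ x (t x))) x₀ :=
    (LinearMap.toContinuousLinearMap (L i)).contMDiff.contMDiffAt.comp x₀ (hcoord ht)
  refine contMDiffAt_of_mulVec_eq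
    (A := fun x ↦ Matrix.of fun i j ↦ L i (τ.linearMapAt ℂ x (e j x)))
    (b := fun x i ↦ L i (τ.linearMapAt ℂ x (s x))) (fun i j ↦ hLsm (he j) i)
    (fun i ↦ hLsm hs i) ?_ ?_ i
  · have : (Matrix.of fun i j ↦ L i (τ.linearMapAt ℂ x₀ (e j x₀))) = (1 : Matrix ι ι ℂ) := by
      ext i j
      simp [hL, Matrix.one_apply]
    simp [this]
  · filter_upwards [hU.mem_nhds hx₀] with x hx
    ext i
    simp [← hc x hx, Matrix.mulVec, dotProduct, mul_comm]

/-- Linear independence of holomorphic sections is an open condition. -/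
theorem eventually_linearIndependent [FiniteDimensional ℂ F] {ι : Type*} [Finite ι] {U : Set X}
    (hU : IsOpen U) {e : ι → Π x, E x} (he : ∀ i, IsHolSection F U (e i)) {x₀ : X} (hx₀ : x₀ ∈ U)
    (hli : LinearIndependent ℂ fun i ↦ e i x₀) :
    ∀ᶠ x in 𝓝 x₀, LinearIndependent ℂ fun i ↦ e i x := by
  let τ := trivializationAt F E x₀
  have hτ : x₀ ∈ τ.baseSet := FiberBundle.mem_baseSet_trivializationAt' x₀
  have hcont : ContinuousAt (fun x i ↦ (τ ⟨x, e i x⟩).2) x₀ :=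
    continuousAt_pi.2 fun i ↦
      ((contMDiffAt_section x₀).1 ((he i).contMDiffAt hU hx₀)).continuousAt
  have hli' : LinearIndependent ℂ fun i ↦ (τ ⟨x₀, e i x₀⟩).2 := by
    simpa only [Function.comp_def, linearMapAt_apply_of_mem τ hτ] using hli.map' _ (ker_linearMapAt τ hτ)
  filter_upwards [hcont.eventually hli'.eventually, τ.open_baseSet.mem_nhds hτ] with x hx hxτ
  refine LinearIndependent.of_comp (τ.linearMapAt ℂ x) ?_
  simpa only [Function.comp_def, linearMapAt_apply_of_mem τ hxτ] using hx

omit [ChartedSpace ℂ X] in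
theorem finrank_fiber (x : X) : Module.finrank ℂ (E x) = Module.finrank ℂ F :=
  ((trivializationAt F E x).linearEquivAt ℂ x
    (FiberBundle.mem_baseSet_trivializationAt' x)).finrank_eq

omit [ChartedSpace ℂ X] in
variable (F) in
theorem finiteDimensional_fiber [FiniteDimensional ℂ F] (x : X) : FiniteDimensional ℂ (E x) :=
  ((trivializationAt F E x).linearEquivAt ℂ x
    (FiberBundle.mem_baseSet_trivializationAt' x)).symm.finiteDimensional

variable [∀ x, IsTopologicalAddGroup (E x)] [∀ x, ContinuousSMul ℂ (E x)]

/-- The covariant derivative of a combination of sections. -/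
theorem covariantDerivative_sum_smul (D : CovariantDerivative 𝓘(ℂ) F E)
    {ι : Type*} [Fintype ι] {e : ι → Π x, E x} {c : X → ι → ℂ} {x : X}
    (he : ∀ i, MDiffAt (T% (e i)) x) (hc : ∀ i, MDiffAt (fun y ↦ c y i) x)
    (v : TangentSpace 𝓘(ℂ) x) :
    D (fun y ↦ ∑ i, c y i • e i y) x v =
      ∑ i, (mvfderiv 𝓘(ℂ) (fun y ↦ c y i) x v • e i x + c x i • D (e i) x v) := by
  have hterm (i : ι) : MDiffAt (T% ((fun y ↦ c y i) • e i)) x := (hc i).smul_section (he i)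
  -- Differentiability of the partial sums is carried along, because additivity of `D` holds only
  -- for differentiable sections.
  have key (A : Finset ι) : MDiffAt (T% (∑ i ∈ A, (fun y ↦ c y i) • e i)) x ∧
      D (∑ i ∈ A, (fun y ↦ c y i) • e i) x v =
        ∑ i ∈ A, (mvfderiv 𝓘(ℂ) (fun y ↦ c y i) x v • e i x + c x i • D (e i) x v) := by
    classical
    induction A using Finset.induction_on with
    | empty =>
      refine ⟨?_, by simp⟩
      exact mdifferentiableAt_zeroSection ℂ E
    | insert i A hi ih =>
      rw [Finset.sum_insert hi, Finset.sum_insert hi]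
      refine ⟨mdifferentiableAt_add_section (hterm i) ih.1, ?_⟩
      rw [D.isCovariantDerivativeOnUniv.add (hterm i) ih.1, add_apply, ih.2,
        D.isCovariantDerivativeOnUniv.leibniz (he i) (hc i)]
      simp [add_comm]
  have h := (key Finset.univ).2
  convert h using 3
  ext y
  simp

omit [VectorBundle ℂ F E] in
theorem covariantDerivative_congr (D : CovariantDerivative 𝓘(ℂ) F E) {s t : Π x, E x} {x : X}
    (hs : MDiffAt (T% s) x) (ht : MDiffAt (T% t) x) (h : ∀ᶠ y in 𝓝 x, s y = t y) :
    D s x = D t x :=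
  D.isCovariantDerivativeOnUniv.congr_of_eventuallyEq hs ht Filter.univ_mem h

end Sections

end SOQuasioper

end

noncomputable section

namespace SOQuasioper

/-! ### Saturations computed from frames of iterated derivatives. -/

section Saturation

variable {X : Type*} [TopologicalSpace X] [ChartedSpace ℂ X]
  {F : Type*} [NormedAddCommGroup F] [NormedSpace ℂ F]
  {E : X → Type*} [TopologicalSpace (TotalSpace F E)]
  [∀ x, AddCommGroup (E x)] [∀ x, Module ℂ (E x)] [∀ x, TopologicalSpace (E x)]
  [∀ x, IsTopologicalAddGroup (E x)] [∀ x, ContinuousSMul ℂ (E x)]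
  [FiberBundle F E]

/-- The tangent line is one-dimensional, so a covariant derivative at a point is determined by its
value on one nonzero vector. -/
theorem tangentSpace_eq_smul {x : X} {w : TangentSpace 𝓘(ℂ) x} (hw : w ≠ 0)
    (v : TangentSpace 𝓘(ℂ) x) : ∃ c : ℂ, v = c • w := by
  have key : ∀ a b : ℂ, a ≠ 0 → ∃ c : ℂ, b = c • a := fun a b ha ↦ ⟨b / a, by simp [ha]⟩
  exact key w v hw

/-- The family of subspaces generated by `V` and the derivatives of its holomorphic sections. -/
def derived (D : CovariantDerivative 𝓘(ℂ) F E) (V : Π x, Submodule ℂ (E x)) (x : X) :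
    Submodule ℂ (E x) :=
  V x ⊔ Submodule.span ℂ {a | ∃ (U : Set X) (s : Π y, E y) (v : TangentSpace 𝓘(ℂ) x),
    IsOpen U ∧ x ∈ U ∧ IsHolSection F U s ∧ (∀ y ∈ U, s y ∈ V y) ∧ D s x v = a}

/-- Every competing subbundle must contain `V` and all values of derivatives of its sections, hence
their span. Existence of the saturation is thereby reduced to showing that this span is a subbundle.
-/
theorem isLeast_derived (D : CovariantDerivative 𝓘(ℂ) F E) {V : Π x, Submodule ℂ (E x)}
    (h : IsHolSubbundle F (derived D V)) : IsLeast (saturations F D V) (derived D V) := by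
  refine ⟨⟨h, fun x ↦ le_sup_left, fun U s hU hs hsV x hx v ↦ ?_⟩, fun W hW x ↦ ?_⟩
  · exact Submodule.mem_sup_right
      (Submodule.subset_span ⟨U, s, v, hU, hx, hs, hsV, rfl⟩)
  · refine sup_le (hW.2.1 x) (Submodule.span_le.2 ?_)
    rintro _ ⟨U, s, v, hU, hx, hs, hsV, rfl⟩
    exact hW.2.2 U s hU hs hsV x hx v

/-- The span at `x` of the sections `e j i` with `j ≤ k`. -/
def frameSpan {ρ : Type*} (e : ℕ → ρ → Π x, E x) (k : ℕ) (x : X) : Submodule ℂ (E x) :=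
  Submodule.span ℂ (Set.range fun p : Fin (k + 1) × ρ ↦ e p.1 p.2 x)

omit [TopologicalSpace X] [ChartedSpace ℂ X] [∀ x, TopologicalSpace (E x)]
  [∀ x, IsTopologicalAddGroup (E x)] [∀ x, ContinuousSMul ℂ (E x)]
  [TopologicalSpace (TotalSpace F E)] [FiberBundle F E] in
theorem mem_frameSpan {ρ : Type*} (e : ℕ → ρ → Π x, E x) {j k : ℕ} (hj : j ≤ k) (i : ρ) (x : X) :
    e j i x ∈ frameSpan e k x :=
  Submodule.subset_span ⟨(⟨j, Nat.lt_succ_of_le hj⟩, i), rfl⟩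

omit [TopologicalSpace X] [ChartedSpace ℂ X] [∀ x, TopologicalSpace (E x)]
  [∀ x, IsTopologicalAddGroup (E x)] [∀ x, ContinuousSMul ℂ (E x)]
  [TopologicalSpace (TotalSpace F E)] [FiberBundle F E] in
theorem frameSpan_le_iff {ρ : Type*} {e : ℕ → ρ → Π x, E x} {k : ℕ} {x : X}
    {W : Submodule ℂ (E x)} :
    frameSpan e k x ≤ W ↔ ∀ j ≤ k, ∀ i, e j i x ∈ W := by
  rw [frameSpan, Submodule.span_le]
  refine ⟨fun h j hj i ↦ h ⟨(⟨j, Nat.lt_succ_of_le hj⟩, i), rfl⟩, ?_⟩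
  rintro h _ ⟨⟨j, i⟩, rfl⟩
  exact h j (Nat.le_of_lt_succ j.2) i

/-- Sections `e 0 i` framing `V` over `U`, together with their iterated derivatives `e j i`,
`j ≤ N`, in the direction of the nowhere vanishing vector field `w`; all of them are linearly
independent. -/
structure IsDerivativeFrame {ρ : Type*} (D : CovariantDerivative 𝓘(ℂ) F E)
    (V : Π x, Submodule ℂ (E x)) (N : ℕ) (U : Set X) (w : Π x : X, TangentSpace 𝓘(ℂ) x)
    (e : ℕ → ρ → Π x, E x) : Prop where
  isOpen : IsOpen U
  isHolSection : ∀ j ≤ N, ∀ i, IsHolSection F U (e j i)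
  ne_zero : ∀ x ∈ U, w x ≠ 0
  deriv : ∀ j < N, ∀ i, ∀ x ∈ U, e (j + 1) i x = D (e j i) x (w x)
  span : ∀ x ∈ U, Submodule.span ℂ (Set.range fun i ↦ e 0 i x) = V x
  linearIndependent : ∀ x ∈ U,
    LinearIndependent ℂ fun p : Fin (N + 1) × ρ ↦ e p.1 p.2 x

namespace IsDerivativeFrame

variable {D : CovariantDerivative 𝓘(ℂ) F E} {V : Π x, Submodule ℂ (E x)} {N : ℕ} {U : Set X}
  {w : Π x : X, TangentSpace 𝓘(ℂ) x} {ρ : Type*} {e : ℕ → ρ → Π x, E x}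

theorem linearIndependent_of_le (h : IsDerivativeFrame D V N U w e) {k : ℕ} (hk : k ≤ N) {x : X}
    (hx : x ∈ U) : LinearIndependent ℂ fun p : Fin (k + 1) × ρ ↦ e p.1 p.2 x :=
  (h.linearIndependent x hx).comp
    (fun p : Fin (k + 1) × ρ ↦ (Fin.castLE (Nat.succ_le_succ hk) p.1, p.2))
    fun _ _ hpq ↦ Prod.ext (Fin.castLE_injective (Nat.succ_le_succ hk) (Prod.ext_iff.1 hpq).1)
      (Prod.ext_iff.1 hpq).2

theorem derivative_mem (h : IsDerivativeFrame D V N U w e) {j : ℕ} (hj : j < N) (i : ρ) {x : X}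
    (hx : x ∈ U) (v : TangentSpace 𝓘(ℂ) x) : D (e j i) x v ∈ frameSpan e (j + 1) x := by
  obtain ⟨c, rfl⟩ := tangentSpace_eq_smul (h.ne_zero x hx) v
  rw [map_smul, ← h.deriv j hj i x hx]
  exact Submodule.smul_mem _ _ (mem_frameSpan e le_rfl i x)

omit [∀ x, TopologicalSpace (E x)] [∀ x, IsTopologicalAddGroup (E x)]
  [∀ x, ContinuousSMul ℂ (E x)] [TopologicalSpace (TotalSpace F E)] [FiberBundle F E]
  [TopologicalSpace X] [ChartedSpace ℂ X] in
theorem frameSpan_mono {j k : ℕ} (hjk : j ≤ k) (x : X) : frameSpan e j x ≤ frameSpan e k x :=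
  frameSpan_le_iff.2 fun _ hl i ↦ mem_frameSpan e (hl.trans hjk) i x

variable [VectorBundle ℂ F E] [FiniteDimensional ℂ F] [Fintype ρ]

theorem derived_eq (h : IsDerivativeFrame D V N U w e) {W : Π x, Submodule ℂ (E x)} {k : ℕ}
    (hk : k < N) (hW : ∀ x ∈ U, W x = frameSpan e k x) {x : X} (hx : x ∈ U) :
    derived D W x = frameSpan e (k + 1) x := by
  apply le_antisymm
  · refine sup_le (hW x hx ▸ frameSpan_mono k.le_succ x) (Submodule.span_le.2 ?_)
    rintro _ ⟨U', s, v, hU', hxU', hs, hsW, rfl⟩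
    have hV : IsOpen (U ∩ U') := h.isOpen.inter hU'
    have hxV : x ∈ U ∩ U' := ⟨hx, hxU'⟩
    -- The coordinates of `s` in the frame; off `U ∩ U'` they are set to 0, so that `choose` yields
    -- a function on all of `X`.
    have hex (y : X) : ∃ c : Fin (k + 1) × ρ → ℂ, y ∈ U ∩ U' →
        ∑ p, c p • e p.1 p.2 y = s y := by
      by_cases hy : y ∈ U ∩ U'
      · obtain ⟨c, hc⟩ := mem_span_range_iff_exists_sum.1 (hW y hy.1 ▸ hsW y hy.2)
        exact ⟨c, fun _ ↦ hc⟩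
      · exact ⟨0, fun hy' ↦ absurd hy' hy⟩
    choose c hc using hex
    have hsV : IsHolSection F (U ∩ U') s := hs.mono Set.inter_subset_right
    have he (p : Fin (k + 1) × ρ) : IsHolSection F (U ∩ U') (e p.1 p.2) :=
      (h.isHolSection p.1 (by omega) p.2).mono Set.inter_subset_left
    have hcs (p : Fin (k + 1) × ρ) : MDiffAt (fun y ↦ c y p) x :=
      (IsHolSection.contMDiffAt_coeff hV he hxV (h.linearIndependent_of_le hk.le hx) hsV hc
        p).mdifferentiableAt (by simp)
    have heq : ∀ᶠ y in 𝓝 x, s y = ∑ p : Fin (k + 1) × ρ, c y p • e p.1 p.2 y := by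
      filter_upwards [hV.mem_nhds hxV] with y hy using (hc y hy).symm
    have hsum : MDiffAt (T% fun y ↦ ∑ p : Fin (k + 1) × ρ, c y p • e p.1 p.2 y) x :=
      MDifferentiableAt.sum_section fun p _ ↦
        (hcs p).smul_section ((he p).mdifferentiableAt hV hxV)
    -- By the Leibniz rule, D(∑ c_p e_p) = ∑ (dc_p e_p + c_p D e_p), where D(e j i) lies in the span
    -- of index j + 1 ≤ k + 1.
    rw [covariantDerivative_congr D (hsV.mdifferentiableAt hV hxV) hsum heq,
      covariantDerivative_sum_smul D (fun p : Fin (k + 1) × ρ ↦ (he p).mdifferentiableAt hV hxV)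
        hcs]
    refine Submodule.sum_mem _ fun p _ ↦ add_mem ?_ ?_
    · exact Submodule.smul_mem _ _ (mem_frameSpan e (by omega) p.2 x)
    · exact Submodule.smul_mem _ _
        (frameSpan_mono (by omega) x (h.derivative_mem (by omega) p.2 hx v))
  · refine frameSpan_le_iff.2 fun j hj i ↦ ?_
    rcases Nat.le_succ_iff.1 hj with hj | rfl
    · exact Submodule.mem_sup_left (hW x hx ▸ mem_frameSpan e hj i x)
    · refine Submodule.mem_sup_right (Submodule.subset_span
        ⟨U, e k i, w x, h.isOpen, hx, h.isHolSection k hk.le i, fun y hy ↦ ?_,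
          (h.deriv k hk i x hx).symm⟩)
      exact hW y hy ▸ mem_frameSpan e le_rfl i y

end IsDerivativeFrame

omit [∀ x, IsTopologicalAddGroup (E x)] [∀ x, ContinuousSMul ℂ (E x)] in
/-- A family of subspaces framed locally by finitely many holomorphic sections is a subbundle. -/
theorem isHolSubbundle_of_frames {W : Π x, Submodule ℂ (E x)}
    (h : ∀ x₀ : X, ∃ U : Set X, IsOpen U ∧ x₀ ∈ U ∧ ∃ (κ : Type) (_ : Fintype κ)
      (s : κ → Π x, E x), (∀ i, IsHolSection F U (s i)) ∧
      ∀ x ∈ U, LinearIndependent ℂ (fun i ↦ s i x) ∧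
        Submodule.span ℂ (Set.range fun i ↦ s i x) = W x) :
    IsHolSubbundle F W := by
  intro x₀
  obtain ⟨U, hU, hx₀, κ, _, s, hs, hspan⟩ := h x₀
  let ε := (Fintype.equivFin κ).symm
  refine ⟨U, hU, hx₀, _, fun i ↦ s (ε i), fun i ↦ hs _, fun x hx ↦
    ⟨(hspan x hx).1.comp ε ε.injective, ?_⟩⟩
  rw [← (hspan x hx).2]
  exact congrArg _ (ε.surjective.range_comp fun i ↦ s i x)

variable [VectorBundle ℂ F E] [FiniteDimensional ℂ F]

section

variable {D : CovariantDerivative 𝓘(ℂ) F E} {V : Π x, Submodule ℂ (E x)} {N : ℕ}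
  (hloc : ∀ x₀ : X, ∃ (U : Set X) (w : Π x : X, TangentSpace 𝓘(ℂ) x) (r : ℕ)
    (e : ℕ → Fin r → Π x, E x), x₀ ∈ U ∧ IsDerivativeFrame D V N U w e)

include hloc

theorem isHolSubbundle_derived {W : Π x, Submodule ℂ (E x)} {k : ℕ} (hk : k < N)
    (hW : ∀ (U : Set X) (w : Π x : X, TangentSpace 𝓘(ℂ) x) (r : ℕ)
      (e : ℕ → Fin r → Π x, E x), IsDerivativeFrame D V N U w e →
      ∀ x ∈ U, W x = frameSpan e k x) :
    IsHolSubbundle F (derived D W) := by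
  refine isHolSubbundle_of_frames fun x₀ ↦ ?_
  obtain ⟨U, w, r, e, hx₀, he⟩ := hloc x₀
  exact ⟨U, he.isOpen, hx₀, Fin (k + 1 + 1) × Fin r, inferInstance, fun p ↦ e p.1 p.2,
    fun p ↦ he.isHolSection _ (by omega) _, fun x hx ↦
      ⟨he.linearIndependent_of_le hk hx, (he.derived_eq hk (hW U w r e he) hx).symm⟩⟩

/-- `saturation` is an intersection of subbundles defined on all of `X`. It can be identified with
`derived` only once the latter is framed near every point, so the induction runs over all derivative
frames simultaneously. -/
theorem iterSaturation_eq_frameSpan {k : ℕ} (hk : k ≤ N) (U : Set X)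
    (w : Π x : X, TangentSpace 𝓘(ℂ) x) (r : ℕ) (e : ℕ → Fin r → Π x, E x)
    (he : IsDerivativeFrame D V N U w e) (x : X) (hx : x ∈ U) :
    iterSaturation F D k V x = frameSpan e k x := by
  induction k generalizing U w r e x with
  | zero =>
    rw [show iterSaturation F D 0 V x = V x from rfl, ← he.span x hx]
    refine le_antisymm (Submodule.span_le.2 ?_) (frameSpan_le_iff.2 fun j hj i ↦ ?_)
    · rintro _ ⟨i, rfl⟩
      exact mem_frameSpan e le_rfl i x
    · obtain rfl := Nat.le_zero.1 hj
      exact Submodule.subset_span ⟨i, rfl⟩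
  | succ k ih =>
    have hW := ih (Nat.le_of_succ_le hk)
    rw [iterSaturation, Function.iterate_succ_apply', ← iterSaturation,
      saturation_eq_of_isLeast F D _ _ (isLeast_derived D (isHolSubbundle_derived hloc hk hW)),
      he.derived_eq hk (hW U w r e he) hx]

theorem isLeast_iterSaturation_succ {k : ℕ} (hk : k < N) :
    IsLeast (saturations F D (iterSaturation F D k V)) (iterSaturation F D (k + 1) V) := by
  rw [iterSaturation, iterSaturation, Function.iterate_succ_apply', ← iterSaturation]
  refine isLeast_saturation F D _ ?_
  have h := isHolSubbundle_derived hloc hk (iterSaturation_eq_frameSpan hloc hk.le)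
  rwa [saturation_eq_of_isLeast F D _ _ (isLeast_derived D h)]

theorem isHolSubbundle_iterSaturation {k : ℕ} (hk : k < N) :
    IsHolSubbundle F (iterSaturation F D (k + 1) V) :=
  (isLeast_iterSaturation_succ hloc hk).1.1

end

end Saturation

end SOQuasioper

end

noncomputable section

namespace SOQuasioper

/-! ### Block antitriangular Gram matrices. -/

section Antitriangular

/-- A family `g j i`, `j ≤ N`, whose Gram matrix is block antitriangular with nondegenerate
antidiagonal has a nondegenerate Gram matrix. -/
theorem eq_zero_of_antitriangular {A ρ : Type*} [AddCommGroup A] [Module ℂ A] [Fintype ρ]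
    (b : A →ₗ[ℂ] A →ₗ[ℂ] ℂ) (N : ℕ) (g : ℕ → ρ → A)
    (hlt : ∀ j k i l, j + k < N → b (g j i) (g k l) = 0)
    (heq : ∀ j k i l, j + k = N → b (g j i) (g k l) = (-1) ^ j * b (g 0 i) (g N l))
    (hnd : ∀ c : ρ → ℂ, (∀ l, ∑ i, c i * b (g 0 i) (g N l) = 0) → c = 0)
    (c : Fin (N + 1) × ρ → ℂ)
    (hc : ∀ q : Fin (N + 1) × ρ, b (∑ p, c p • g p.1 p.2) (g q.1 q.2) = 0) : c = 0 := by
  -- Descending induction on j. Pairing with `g (N - j) l` kills the blocks k < j by `hlt` and the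
  -- blocks k > j by induction; the block k = j remains and is nondegenerate.
  have key : ∀ d, ∀ j : Fin (N + 1), N - j = d → ∀ i, c (j, i) = 0 := by
    intro d
    induction d using Nat.strong_induction_on with
    | _ d ih =>
      intro j hj
      have hj' : (N - j : ℕ) < N + 1 := by omega
      have h0 : (fun i ↦ c (j, i)) = 0 := by
        refine hnd _ fun l ↦ ?_
        have h := hc (⟨N - j, hj'⟩, l)
        simp only [map_sum, map_smul, LinearMap.sum_apply, LinearMap.smul_apply, smul_eq_mul,
          Fintype.sum_prod_type] at h
        rw [Finset.sum_eq_single j] at h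
        · have h2 : (-1 : ℂ) ^ (j : ℕ) * ∑ i, c (j, i) * b (g 0 i) (g N l) = 0 := by
            rw [Finset.mul_sum, ← h]
            refine Finset.sum_congr rfl fun i _ ↦ ?_
            rw [heq j (N - j) i l (by omega)]
            ring
          exact (mul_eq_zero.1 h2).resolve_left (pow_ne_zero _ (by norm_num))
        · intro k _ hk
          refine Finset.sum_eq_zero fun i _ ↦ ?_
          rcases lt_or_gt_of_ne hk with hk | hk
          · have : (k : ℕ) < j := hk
            rw [hlt k (N - j) i l (by omega), mul_zero]
          · have : (j : ℕ) < k := hk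
            rw [ih (N - k) (by omega) k rfl i, zero_mul]
        · simp
      exact fun i ↦ congrFun h0 i
  ext ⟨j, i⟩
  exact key _ j rfl i

end Antitriangular

/-! ### Holomorphic complements of subbundles. -/

section Complement

variable {X : Type*} [TopologicalSpace X] [ChartedSpace ℂ X]
  {F : Type*} [NormedAddCommGroup F] [NormedSpace ℂ F] [FiniteDimensional ℂ F]
  {E : X → Type*} [TopologicalSpace (TotalSpace F E)]
  [∀ x, AddCommGroup (E x)] [∀ x, Module ℂ (E x)] [∀ x, TopologicalSpace (E x)]
  [FiberBundle F E] [VectorBundle ℂ F E] [ContMDiffVectorBundle ω F E 𝓘(ℂ)]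

/-- A fibrewise complement of a subbundle is a subbundle if holomorphic sections split
holomorphically. -/
theorem isHolDirectSum_of_isCompl {P S : Π x, Submodule ℂ (E x)} (hP : IsHolSubbundle F P)
    (hcompl : ∀ x, IsCompl (P x) (S x))
    (hsec : ∀ (U : Set X) (s : Π x, E x), IsOpen U → IsHolSection F U s →
      ∃ a b : Π x, E x, IsHolSection F U a ∧ IsHolSection F U b ∧
        ∀ x ∈ U, a x ∈ P x ∧ b x ∈ S x ∧ a x + b x = s x) :
    IsHolDirectSum F P S where
  subbundle_left := hP
  bijective x := (Submodule.prodEquivOfIsCompl _ _ (hcompl x)).bijective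
  sections := hsec
  subbundle_right := by
    intro x₀
    have hfd (x : X) := finiteDimensional_fiber (E := E) F x
    obtain ⟨U, hU, hx₀, k, e, -, hespan⟩ := hP x₀
    have hrank (x : X) (hx : x ∈ U) : Module.finrank ℂ (S x) = Module.finrank ℂ F - k := by
      have h1 := Submodule.finrank_add_eq_of_isCompl (hcompl x)
      rw [finrank_fiber (F := F) x, ← (hespan x hx).2, finrank_span_eq_card (hespan x hx).1,
        Fintype.card_fin] at h1
      omega
    let v := Module.finBasis ℂ (S x₀)
    choose W t hW hxW ht htv _ using fun i ↦ exists_isHolSection_eq (F := F) (v i : E x₀)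
    have hW' : IsOpen (⋂ i, W i) := isOpen_iInter_of_finite hW
    have hxW' : x₀ ∈ ⋂ i, W i := Set.mem_iInter.2 hxW
    -- The candidate frame of `S` consists of the `S`-components `b i` of local extensions of a
    -- basis of `S x₀`. At `x₀` they give back the basis, so they stay independent nearby.
    choose a b ha hb hab using fun i ↦
      hsec (⋂ i, W i) (t i) hW' ((ht i).mono (Set.iInter_subset W i))
    have hbv (i) : b i x₀ = v i := by
      obtain ⟨h1, h2, h3⟩ := hab i x₀ hxW'
      have h4 : a i x₀ ∈ S x₀ := by
        rw [← add_sub_cancel_right (a i x₀) (b i x₀), h3, htv i]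
        exact sub_mem (v i).2 h2
      have h5 : a i x₀ = 0 := Submodule.disjoint_def.1 (hcompl x₀).disjoint _ h1 h4
      rw [← htv i, ← h3, h5, zero_add]
    have hli : LinearIndependent ℂ fun i ↦ b i x₀ := by
      simp only [hbv]
      exact v.linearIndependent.map' (S x₀).subtype (Submodule.ker_subtype _)
    obtain ⟨U', hU'sub, hU', hxU'⟩ := mem_nhds_iff.1
      (eventually_linearIndependent hW' hb hxW' hli)
    refine ⟨U' ∩ (U ∩ ⋂ i, W i), hU'.inter (hU.inter hW'), ⟨hxU', hx₀, hxW'⟩, _, b,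
      fun i ↦ (hb i).mono fun x hx ↦ hx.2.2, fun x hx ↦ ⟨hU'sub hx.1, ?_⟩⟩
    -- The `b i x` lie in `S x`, and `S` has constant rank near `x₀` because its complement `P`
    -- does.
    refine Submodule.eq_of_le_of_finrank_eq (Submodule.span_le.2 ?_) ?_
    · rintro _ ⟨i, rfl⟩
      exact (hab i x hx.2.2).2.1
    · rw [finrank_span_eq_card (hU'sub hx.1), Fintype.card_fin, hrank x hx.2.1, hrank x₀ hx₀]

end Complement

end SOQuasioper

end

noncomputable section

namespace SOQuasioper

/-! ### Generators of graded pieces from surjective second fundamental forms. -/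

section SecondFundamentalForm

variable {X : Type*} [TopologicalSpace X] [ChartedSpace ℂ X]
  {F : Type*} [NormedAddCommGroup F] [NormedSpace ℂ F]
  {E : X → Type*} [TopologicalSpace (TotalSpace F E)]
  [∀ x, AddCommGroup (E x)] [∀ x, Module ℂ (E x)] [∀ x, TopologicalSpace (E x)]
  [∀ x, IsTopologicalAddGroup (E x)] [∀ x, ContinuousSMul ℂ (E x)]
  [FiberBundle F E] [VectorBundle ℂ F E]

theorem exists_dual_tangent {x : X} {w : TangentSpace 𝓘(ℂ) x} (hw : w ≠ 0) :
    ∃ l : TangentSpace 𝓘(ℂ) x →ₗ[ℂ] ℂ, l w = 1 := by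
  have key : ∀ a : ℂ, a ≠ 0 → ∃ l : ℂ →ₗ[ℂ] ℂ, l a = 1 :=
    fun a ha ↦ ⟨a⁻¹ • LinearMap.id, by simp [ha]⟩
  exact key w hw

theorem quot_mk_eq_iff {A : Type*} [AddCommGroup A] [Module ℂ A] {V W : Submodule ℂ A} {a b : V} :
    (Submodule.Quotient.mk a : quot V W) = Submodule.Quotient.mk b ↔ (a : A) - b ∈ W := by
  rw [Submodule.Quotient.eq]
  exact Iff.rfl

theorem exists_quot_mk_sum {A ρ : Type*} [AddCommGroup A] [Module ℂ A] [Fintype ρ]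
    {V W : Submodule ℂ A} {g : ρ → A} (hg : ∀ i, g i ∈ V)
    (h : V ≤ W ⊔ Submodule.span ℂ (Set.range g)) (q : quot V W) :
    ∃ c : ρ → ℂ, q = Submodule.Quotient.mk
      ⟨∑ i, c i • g i, V.sum_mem fun i _ ↦ V.smul_mem _ (hg i)⟩ := by
  obtain ⟨⟨a, ha⟩, rfl⟩ := Submodule.Quotient.mk_surjective _ q
  obtain ⟨u, hu, y, hy, rfl⟩ := Submodule.mem_sup.1 (h ha)
  obtain ⟨c, rfl⟩ := mem_span_range_iff_exists_sum.1 hy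
  exact ⟨c, quot_mk_eq_iff.2 (by simpa using hu)⟩

theorem covariantDerivative_sum_const_smul (D : CovariantDerivative 𝓘(ℂ) F E)
    {ρ : Type*} [Fintype ρ] {e : ρ → Π x, E x} (c : ρ → ℂ) {x : X}
    (he : ∀ i, MDiffAt (T% (e i)) x) (v : TangentSpace 𝓘(ℂ) x) :
    D (fun y ↦ ∑ i, c i • e i y) x v = ∑ i, c i • D (e i) x v := by
  refine (covariantDerivative_sum_smul D (c := fun _ ↦ c) he
    (fun i ↦ mdifferentiableAt_const) v).trans ?_
  simp [mvfderiv_const]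

variable {D : CovariantDerivative 𝓘(ℂ) F E} {V₀ V₁ V₂ V₃ : Π x, Submodule ℂ (E x)}
  {U : Set X} {ρ : Type*} [Fintype ρ] {e : ρ → Π x, E x} {x : X}

theorem IsSecondFundamentalForm.apply_sum
    {φ : quot (V₁ x) (V₀ x) →ₗ[ℂ] TangentSpace 𝓘(ℂ) x →ₗ[ℂ] quot (V₃ x) (V₂ x)}
    (hφ : IsSecondFundamentalForm F D V₀ V₁ V₂ V₃ x φ) (hU : IsOpen U) (hx : x ∈ U)
    (he : ∀ i, IsHolSection F U (e i)) (heV : ∀ i, ∀ y ∈ U, e i y ∈ V₁ y)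
    (hDe : ∀ i, ∀ v : TangentSpace 𝓘(ℂ) x, D (e i) x v ∈ V₃ x) (c : ρ → ℂ)
    (v : TangentSpace 𝓘(ℂ) x) :
    φ (Submodule.Quotient.mk ⟨∑ i, c i • e i x,
      (V₁ x).sum_mem fun i _ ↦ (V₁ x).smul_mem _ (heV i x hx)⟩) v =
    Submodule.Quotient.mk ⟨∑ i, c i • D (e i) x v,
      (V₃ x).sum_mem fun i _ ↦ (V₃ x).smul_mem _ (hDe i v)⟩ := by
  obtain ⟨h, h'⟩ := hφ U (fun y ↦ ∑ i, c i • e i y) hx hU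
    (IsHolSection.sum_smul (c := fun _ ↦ c) (fun i ↦ contMDiffOn_const) he)
    (fun y hy ↦ (V₁ y).sum_mem fun i _ ↦ (V₁ y).smul_mem _ (heV i y hy)) v
  refine h'.trans (quot_mk_eq_iff.2 ?_)
  simp [covariantDerivative_sum_const_smul D c fun i ↦ (he i).mdifferentiableAt hU hx]

/-- If `V₁ / V₀` is generated by sections `e i` and the second fundamental form
`V₁ / V₀ → (V₂ / V₁) ⊗ K` is onto, then `V₂ / V₁` is generated by the derivatives of the `e i`. -/
theorem IsSecondFundamentalForm.le_sup_span
    {φ : quot (V₁ x) (V₀ x) →ₗ[ℂ] TangentSpace 𝓘(ℂ) x →ₗ[ℂ] quot (V₂ x) (V₁ x)}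
    (hφ : IsSecondFundamentalForm F D V₀ V₁ V₁ V₂ x φ) (hsurj : Function.Surjective φ)
    (hU : IsOpen U) (hx : x ∈ U)
    (he : ∀ i, IsHolSection F U (e i)) (heV : ∀ i, ∀ y ∈ U, e i y ∈ V₁ y)
    (hDe : ∀ i, ∀ v : TangentSpace 𝓘(ℂ) x, D (e i) x v ∈ V₂ x)
    (hgen : V₁ x ≤ V₀ x ⊔ Submodule.span ℂ (Set.range fun i ↦ e i x))
    {w : TangentSpace 𝓘(ℂ) x} (hw : w ≠ 0) :
    V₂ x ≤ V₁ x ⊔ Submodule.span ℂ (Set.range fun i ↦ D (e i) x w) := by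
  intro a ha
  obtain ⟨l, hl⟩ := exists_dual_tangent hw
  -- Surjectivity is applied to the homomorphism on the tangent line that sends `w` to the class of
  -- `a`; evaluating at `w` recovers `a` modulo `V₁ x`.
  obtain ⟨q, hq⟩ := hsurj (l.smulRight (Submodule.Quotient.mk ⟨a, ha⟩))
  obtain ⟨c, rfl⟩ := exists_quot_mk_sum (fun i ↦ heV i x hx) hgen q
  have h := LinearMap.congr_fun hq w
  rw [hφ.apply_sum hU hx he heV hDe, LinearMap.smulRight_apply, hl, one_smul] at h
  refine Submodule.mem_sup.2 ⟨a - ∑ i, c i • D (e i) x w, quot_mk_eq_iff.1 h.symm, _,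
    mem_span_range_iff_exists_sum.2 ⟨c, rfl⟩, by abel⟩

/-- The analogue of `IsSecondFundamentalForm.le_sup_span` for a composition of two second
fundamental forms. -/
theorem IsSecondFundamentalForm.comp_le_sup_span
    {φ : quot (V₁ x) (V₀ x) →ₗ[ℂ] TangentSpace 𝓘(ℂ) x →ₗ[ℂ] quot (V₂ x) (V₁ x)}
    {ψ : quot (V₂ x) (V₁ x) →ₗ[ℂ] TangentSpace 𝓘(ℂ) x →ₗ[ℂ] quot (V₃ x) (V₂ x)}
    (hφ : IsSecondFundamentalForm F D V₀ V₁ V₁ V₂ x φ)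
    (hψ : IsSecondFundamentalForm F D V₁ V₂ V₂ V₃ x ψ)
    (hsurj : Function.Surjective fun q ↦ ψ ∘ₗ φ q)
    (hU : IsOpen U) (hx : x ∈ U)
    (he : ∀ i, IsHolSection F U (e i)) (heV : ∀ i, ∀ y ∈ U, e i y ∈ V₁ y)
    (hDe : ∀ i, ∀ v : TangentSpace 𝓘(ℂ) x, D (e i) x v ∈ V₂ x)
    {w : Π x : X, TangentSpace 𝓘(ℂ) x} {e' : ρ → Π x, E x}
    (hee' : ∀ i, D (e i) x (w x) = e' i x)
    (he' : ∀ i, IsHolSection F U (e' i)) (he'V : ∀ i, ∀ y ∈ U, e' i y ∈ V₂ y)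
    (hDe' : ∀ i, ∀ v : TangentSpace 𝓘(ℂ) x, D (e' i) x v ∈ V₃ x)
    (hgen : V₁ x ≤ V₀ x ⊔ Submodule.span ℂ (Set.range fun i ↦ e i x)) (hw : w x ≠ 0) :
    V₃ x ≤ V₂ x ⊔ Submodule.span ℂ (Set.range fun i ↦ D (e' i) x (w x)) := by
  intro a ha
  obtain ⟨l, hl⟩ := exists_dual_tangent hw
  obtain ⟨q, hq⟩ := hsurj (l.smulRight (l.smulRight (Submodule.Quotient.mk ⟨a, ha⟩)))
  obtain ⟨c, rfl⟩ := exists_quot_mk_sum (fun i ↦ heV i x hx) hgen q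
  have h := LinearMap.congr_fun (LinearMap.congr_fun hq (w x)) (w x)
  simp only [LinearMap.comp_apply, hφ.apply_sum hU hx he heV hDe, hee',
    hψ.apply_sum hU hx he' he'V hDe', LinearMap.smulRight_apply, hl, one_smul] at h
  refine Submodule.mem_sup.2 ⟨a - ∑ i, c i • D (e' i) x (w x), quot_mk_eq_iff.1 h.symm, _,
    mem_span_range_iff_exists_sum.2 ⟨c, rfl⟩, by abel⟩

end SecondFundamentalForm

end SOQuasioper

end

noncomputable section

namespace SOQuasioper

/-! ### Local vector fields and holomorphic pairings. -/

section Local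

variable {X : Type*} [TopologicalSpace X] [ChartedSpace ℂ X]
  {F : Type*} [NormedAddCommGroup F] [NormedSpace ℂ F]
  {E : X → Type*} [TopologicalSpace (TotalSpace F E)]
  [∀ x, AddCommGroup (E x)] [∀ x, Module ℂ (E x)] [∀ x, TopologicalSpace (E x)]
  [∀ x, IsTopologicalAddGroup (E x)] [∀ x, ContinuousSMul ℂ (E x)]
  [FiberBundle F E] [VectorBundle ℂ F E]

theorem exists_vectorField [IsManifold 𝓘(ℂ) ω X] (x₀ : X) :
    ∃ (U : Set X) (w : Π x : X, TangentSpace 𝓘(ℂ) x), IsOpen U ∧ x₀ ∈ U ∧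
      IsHolSection (E := fun x : X ↦ TangentSpace 𝓘(ℂ) x) ℂ U w ∧ ∀ x ∈ U, w x ≠ 0 := by
  -- The tangent bundle loses one order of differentiability, which costs nothing since ω + 1 = ω.
  have : IsManifold 𝓘(ℂ) (ω + 1) X := inferInstanceAs (IsManifold 𝓘(ℂ) ω X)
  obtain ⟨a, ha⟩ : ∃ a : TangentSpace 𝓘(ℂ) x₀, a ≠ 0 := exists_ne (0 : ℂ)
  obtain ⟨U, w, hU, hx, hw, -, hne⟩ :=
    exists_isHolSection_eq (F := ℂ) (E := fun x : X ↦ TangentSpace 𝓘(ℂ) x) a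
  exact ⟨U, w, hU, hx, hw, hne ha⟩

theorem IsHolConnection.isHolSection_apply [IsManifold 𝓘(ℂ) ω X]
    {D : CovariantDerivative 𝓘(ℂ) F E}
    (hD : IsHolConnection F D) {U : Set X} (hU : IsOpen U) {s : Π x, E x}
    (hs : IsHolSection F U s) {w : Π x : X, TangentSpace 𝓘(ℂ) x}
    (hw : IsHolSection (E := fun x : X ↦ TangentSpace 𝓘(ℂ) x) ℂ U w) :
    IsHolSection F U fun x ↦ D s x (w x) :=
  ContMDiffOn.clm_bundle_apply (F₁ := ℂ) (E₁ := fun x : X ↦ TangentSpace 𝓘(ℂ) x)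
    ((hD U hU).contMDiff hs) hw

omit [∀ x, IsTopologicalAddGroup (E x)] [∀ x, ContinuousSMul ℂ (E x)] in
theorem contMDiffOn_apply {U : Set X} {φ : Π x, DualBundle E x} {t : Π x, E x}
    (hφ : IsHolSection (F →L[ℂ] ℂ) U φ) (ht : IsHolSection F U t) :
    ContMDiffOn 𝓘(ℂ) 𝓘(ℂ) ω (fun x ↦ φ x (t x)) U := by
  intro x hx
  have h := ContMDiffWithinAt.clm_bundle_apply (F₁ := F) (F₂ := ℂ) (E₂ := Bundle.Trivial X ℂ)
    (b := fun y : X ↦ y) (ϕ := φ) (v := t) (hφ x hx) (ht x hx)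
  exact (contMDiffWithinAt_totalSpace.1 h).2

end Local

/-! ### Towers of derivatives of a frame of F₁ and their Gram matrix. -/

namespace GeneralizedQuasioper

set_option linter.unusedSectionVars false

variable {X : Type*} [TopologicalSpace X] [ChartedSpace ℂ X] [IsManifold 𝓘(ℂ) ω X]
  {F : Type*} [NormedAddCommGroup F] [NormedSpace ℂ F] [FiniteDimensional ℂ F]
  {E : X → Type*} [TopologicalSpace (TotalSpace F E)]
  [∀ x, AddCommGroup (E x)] [∀ x, Module ℂ (E x)] [∀ x, TopologicalSpace (E x)]
  [∀ x, IsTopologicalAddGroup (E x)] [∀ x, ContinuousSMul ℂ (E x)]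
  [FiberBundle F E] [VectorBundle ℂ F E] [ContMDiffVectorBundle ω F E 𝓘(ℂ)] {n m : ℕ}

/-- The section `B(s, ·)` of `E*`. -/
def flat (Q : GeneralizedQuasioper F E n m) (s : Π x, E x) : Π x, DualBundle E x :=
  fun x ↦ Q.B x (s x)

theorem isHolSection_flat (Q : GeneralizedQuasioper F E n m) {U : Set X} {s : Π x, E x}
    (hs : IsHolSection F U s) : IsHolSection (F →L[ℂ] ℂ) U (Q.flat s) :=
  ContMDiffOn.clm_bundle_apply (F₁ := F) (F₂ := F →L[ℂ] ℂ)
    (E₂ := fun x ↦ E x →L[ℂ] Bundle.Trivial X ℂ x) Q.isSOStructure.holomorphic.contMDiffOn hs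

theorem contMDiffOn_B (Q : GeneralizedQuasioper F E n m) {U : Set X} {s t : Π x, E x}
    (hs : IsHolSection F U s) (ht : IsHolSection F U t) :
    ContMDiffOn 𝓘(ℂ) 𝓘(ℂ) ω (fun x ↦ Q.B x (s x) (t x)) U :=
  contMDiffOn_apply (Q.isHolSection_flat hs) ht

/-- `B` carries `D` to the dual connection. -/
theorem dualD_flat (Q : GeneralizedQuasioper F E n m) {U : Set X} (hU : IsOpen U) {s : Π x, E x}
    (hs : IsHolSection F U s) {x : X} (hx : x ∈ U) (v : TangentSpace 𝓘(ℂ) x) :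
    Q.dualD (Q.flat s) x v = Q.B x (Q.D s x v) := by
  refine ContinuousLinearMap.ext fun a ↦ ?_
  obtain ⟨U', t, hU', hx', ht, rfl, -⟩ := exists_isHolSection_eq (F := F) a
  have hV := hU.inter hU'
  have hxV : x ∈ U ∩ U' := ⟨hx, hx'⟩
  have hsV : IsHolSection F (U ∩ U') s := hs.mono Set.inter_subset_left
  have htV : IsHolSection F (U ∩ U') t := ht.mono Set.inter_subset_right
  have h := dualConnection_apply Q.D (φ := Q.flat s) (s := t)
    ((Q.isHolSection_flat hsV).mdifferentiableAt hV hxV) (htV.mdifferentiableAt hV hxV) v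
  have h' := Q.isFilteredConnection.compatible (U ∩ U') s t hV hsV htV x hxV v
  -- (D*B(s, ·))(t) = d B(s, t) - B(s, Dt), and compatibility turns this into B(Ds, t).
  refine h.trans ?_
  rw [show pairing (Q.flat s) t = fun y ↦ Q.B y (s y) (t y) from rfl, h']
  exact add_sub_cancel_right _ _

/-- A holomorphic frame `e 0 i` of `F₁` over `U`, with its iterated derivatives `e j i` in the
direction of a nowhere vanishing holomorphic vector field `w`. -/
structure IsTower (Q : GeneralizedQuasioper F E n m) (U : Set X)
    (w : Π x : X, TangentSpace 𝓘(ℂ) x) {r : ℕ} (e : ℕ → Fin r → Π x, E x) : Prop where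
  isOpen : IsOpen U
  ne_zero : ∀ x ∈ U, w x ≠ 0
  isHolSection : ∀ j i, IsHolSection F U (e j i)
  deriv : ∀ j i x, e (j + 1) i x = Q.D (e j i) x (w x)
  frame : ∀ x ∈ U, LinearIndependent ℂ (fun i ↦ e 0 i x) ∧
    Submodule.span ℂ (Set.range fun i ↦ e 0 i x) = Q.Fil 1 x

theorem exists_isTower (Q : GeneralizedQuasioper F E n m) (x₀ : X) :
    ∃ (U : Set X) (w : Π x : X, TangentSpace 𝓘(ℂ) x) (r : ℕ) (e : ℕ → Fin r → Π x, E x),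
      x₀ ∈ U ∧ Q.IsTower U w e := by
  obtain ⟨U₁, hU₁, hx₁, r, s, hs, hframe⟩ := Q.isFiltration.subbundle 1 (by omega) x₀
  obtain ⟨U₂, w, hU₂, hx₂, hw, hne⟩ := exists_vectorField x₀
  let e : ℕ → Fin r → Π x, E x := fun j ↦ Nat.rec s (fun _ t i x ↦ Q.D (t i) x (w x)) j
  refine ⟨U₁ ∩ U₂, w, r, e, ⟨hx₁, hx₂⟩, hU₁.inter hU₂, fun x hx ↦ hne x hx.2, fun j ↦ ?_,
    fun j i x ↦ rfl, fun x hx ↦ hframe x hx.1⟩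
  induction j with
  | zero => exact fun i ↦ (hs i).mono Set.inter_subset_left
  | succ j ih =>
    exact fun i ↦ Q.isFilteredConnection.holomorphic.isHolSection_apply (hU₁.inter hU₂) (ih i)
      (hw.mono Set.inter_subset_right)

namespace IsTower

variable {Q : GeneralizedQuasioper F E n m} {U : Set X} {w : Π x : X, TangentSpace 𝓘(ℂ) x}
  {r : ℕ} {e : ℕ → Fin r → Π x, E x}

theorem mem_fil (h : Q.IsTower U w e) {j : ℕ} (hj : j ≤ 2 * m) (i : Fin r) :
    ∀ x ∈ U, e j i x ∈ Q.Fil (j + 1) x := by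
  induction j with
  | zero =>
    intro x hx
    rw [zero_add, ← (h.frame x hx).2]
    exact Submodule.subset_span ⟨i, rfl⟩
  | succ j ih =>
    intro x hx
    rw [h.deriv]
    exact Q.isFilteredConnection.mapsInto (j + 1) (by omega) hj U (e j i) h.isOpen
      (h.isHolSection j i) (ih (by omega)) x hx (w x)

theorem derivative_mem_fil (h : Q.IsTower U w e) {j : ℕ} (hj : j + 1 ≤ 2 * m) (i : Fin r)
    {x : X} (hx : x ∈ U) (v : TangentSpace 𝓘(ℂ) x) : Q.D (e j i) x v ∈ Q.Fil (j + 2) x :=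
  Q.isFilteredConnection.mapsInto (j + 1) (by omega) hj U (e j i) h.isOpen
    (h.isHolSection j i) (h.mem_fil (by omega) i) x hx v

/-- Away from the middle, `F_{j+1} / F_j` is generated by the `j`-th derivatives. -/
theorem fil_le (h : Q.IsTower U w e) (hm : 2 ≤ m) {j : ℕ} (hj : j ≤ 2 * m) (hjm : j ≠ m) {x : X}
    (hx : x ∈ U) :
    Q.Fil (j + 1) x ≤ Q.Fil j x ⊔ Submodule.span ℂ (Set.range fun i ↦ e j i x) := by
  induction j using Nat.strong_induction_on with
  | _ j ih =>
    rcases j with _ | j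
    · rw [(h.frame x hx).2]
      exact le_sup_right
    -- Here the target is F_{m+2} / F_{m+1}. The derivatives need not generate the middle piece,
    -- which has twice the rank, so the induction jumps over it from F_m / F_{m-1} by the composed
    -- second fundamental form.
    by_cases hjm' : j = m
    · subst hjm'
      obtain ⟨k, rfl⟩ : ∃ k, j = k + 1 := ⟨j - 1, by omega⟩
      obtain ⟨φ, ψ, hφ, hψ, hbij⟩ := Q.isFilteredConnection.second_comp_iso x
      have := hφ.comp_le_sup_span hψ hbij.2 h.isOpen hx (h.isHolSection k)
        (fun i ↦ h.mem_fil (by omega) i) (fun i v ↦ h.derivative_mem_fil (by omega) i hx v)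
        (fun i ↦ (h.deriv k i x).symm) (h.isHolSection (k + 1))
        (fun i ↦ h.mem_fil (by omega) i) (fun i v ↦ h.derivative_mem_fil (by omega) i hx v)
        (ih k (by omega) (by omega) (by omega)) (h.ne_zero x hx)
      simpa only [h.deriv (k + 1)] using this
    · obtain ⟨φ, hφ, hbij⟩ := Q.isFilteredConnection.second_iso (j + 1) (by omega) hj hjm
        (by omega) x
      have := hφ.le_sup_span hbij.2 h.isOpen hx (h.isHolSection j)
        (fun i ↦ h.mem_fil (by omega) i) (fun i v ↦ h.derivative_mem_fil (by omega) i hx v)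
        (ih j (by omega) (by omega) hjm') (h.ne_zero x hx)
      simpa only [h.deriv j] using this

theorem B_eq_zero (h : Q.IsTower U w e) {j k : ℕ} (hjk : j + k < 2 * m) (i l : Fin r) {x : X}
    (hx : x ∈ U) : Q.B x (e j i x) (e k l x) = 0 := by
  -- Orthogonality is given only for F_i with i ≤ m. When j + k < 2m, one of j + 1 and k + 1 is at
  -- most m, and symmetry of B reduces to that case.
  have key {j k : ℕ} (hjk : j + k < 2 * m) (hj : j + 1 ≤ m) (i l : Fin r) :
      Q.B x (e j i x) (e k l x) = 0 := by
    have hmono : ∀ d a, a + d ≤ 2 * m + 1 → Q.Fil a x ≤ Q.Fil (a + d) x := by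
      intro d a
      induction d with
      | zero => exact fun _ ↦ le_rfl
      | succ d ih => exact fun hd ↦ (ih (by omega)).trans (Q.isFiltration.mono _ (by omega) x)
    obtain ⟨d, hd⟩ : ∃ d, 2 * m + 1 - (j + 1) = (k + 1) + d := ⟨2 * m - j - (k + 1), by omega⟩
    refine (Q.isFiltration.perp (j + 1) hj x (e k l x)).2 ?_ _ (h.mem_fil (by omega) i x hx)
    rw [hd]
    exact hmono d (k + 1) (by omega) (h.mem_fil (by omega) l x hx)
  by_cases hj : j + 1 ≤ m
  · exact key hjk hj i l
  · rw [Q.isSOStructure.symm]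
    exact key (by omega) (by omega) l i

/-- Since j + k < 2m, the function B(e j i, e k l) vanishes identically on `U`; differentiating it
along w gives the relation. -/
theorem B_succ (h : Q.IsTower U w e) {j k : ℕ} (hjk : j + k + 1 = 2 * m) (i l : Fin r) {x : X}
    (hx : x ∈ U) :
    Q.B x (e (j + 1) i x) (e k l x) = -Q.B x (e j i x) (e (k + 1) l x) := by
  have h1 := Q.isFilteredConnection.compatible U (e j i) (e k l) h.isOpen (h.isHolSection j i)
    (h.isHolSection k l) x hx (w x)
  have h2 : (fun y ↦ Q.B y (e j i y) (e k l y)) =ᶠ[𝓝 x] fun _ ↦ 0 := by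
    filter_upwards [h.isOpen.mem_nhds hx] with y hy using h.B_eq_zero (by omega) i l hy
  have h3 : mvfderiv 𝓘(ℂ) (fun y ↦ Q.B y (e j i y) (e k l y)) x (w x) = 0 := by
    have h4 : mvfderiv 𝓘(ℂ) (fun y ↦ Q.B y (e j i y) (e k l y)) x =
        mvfderiv 𝓘(ℂ) (fun _ ↦ (0 : ℂ)) x := by
      have := h2.mfderiv_eq (I := 𝓘(ℂ)) (I' := 𝓘(ℂ))
      simp only [mvfderiv, this]
      rfl
    rw [h4, mvfderiv_const]
    rfl
  rw [h3, ← h.deriv, ← h.deriv] at h1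
  exact eq_neg_of_add_eq_zero_left h1.symm

theorem B_eq (h : Q.IsTower U w e) {j k : ℕ} (hjk : j + k = 2 * m) (i l : Fin r) {x : X}
    (hx : x ∈ U) :
    Q.B x (e j i x) (e k l x) = (-1) ^ j * Q.B x (e 0 i x) (e (2 * m) l x) := by
  induction j generalizing k with
  | zero => rw [← hjk]; simp
  | succ j ih =>
    rw [h.B_succ (by omega) i l hx, ih (by omega)]
    ring

/-- The combination u = ∑ c_i e 0 i lies in F₁, so it is orthogonal to F_{2m}. By hypothesis it is
also orthogonal to the `e (2m) l`, which together with F_{2m} span E. Hence u = 0. -/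
theorem antidiagonal_nondegenerate (h : Q.IsTower U w e) (hm : 2 ≤ m) {x : X} (hx : x ∈ U)
    (c : Fin r → ℂ) (hc : ∀ l, ∑ i, c i * Q.B x (e 0 i x) (e (2 * m) l x) = 0) : c = 0 := by
  set u := ∑ i, c i • e 0 i x with hu
  have huF : u ∈ Q.Fil 1 x :=
    Submodule.sum_mem _ fun i _ ↦ Submodule.smul_mem _ _ (h.mem_fil (by omega) i x hx)
  have hle : (⊤ : Submodule ℂ (E x)) ≤ LinearMap.ker (Q.B x u : E x →ₗ[ℂ] ℂ) := by
    rw [← Q.isFiltration.top x]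
    refine (h.fil_le hm le_rfl (by omega) hx).trans (sup_le (fun a ha ↦ ?_)
      (Submodule.span_le.2 ?_))
    · exact (Q.isFiltration.perp 1 (by omega) x a).2 ha u huF
    · rintro _ ⟨l, rfl⟩
      simpa [hu] using hc l
  have hu0 : u = 0 := Q.isSOStructure.nondegenerate x u fun f ↦ by
    rw [Q.isSOStructure.symm]
    exact hle (Submodule.mem_top : f ∈ ⊤)
  funext i
  exact Fintype.linearIndependent_iff.1 (h.frame x hx).1 c hu0 i

/-- The restriction of `B` to the span of the sections `e j i`, `j ≤ 2m`, is nondegenerate, and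
these sections are linearly independent. -/
theorem coeff_eq_zero (h : Q.IsTower U w e) (hm : 2 ≤ m) {x : X} (hx : x ∈ U)
    (c : Fin (2 * m + 1) × Fin r → ℂ)
    (hc : ∀ q : Fin (2 * m + 1) × Fin r, Q.B x (∑ p, c p • e p.1 p.2 x) (e q.1 q.2 x) = 0) :
    c = 0 :=
  eq_zero_of_antitriangular
    ((ContinuousLinearMap.coeLM ℂ : (E x →L[ℂ] ℂ) →ₗ[ℂ] E x →ₗ[ℂ] ℂ) ∘ₗ
      (Q.B x : E x →ₗ[ℂ] E x →L[ℂ] ℂ)) (2 * m) (fun j i ↦ e j i x)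
    (fun _ _ i l hjk ↦ h.B_eq_zero hjk i l hx) (fun _ _ i l hjk ↦ h.B_eq hjk i l hx)
    (fun c hc ↦ h.antidiagonal_nondegenerate hm hx c hc) c hc

theorem isDerivativeFrame (h : Q.IsTower U w e) (hm : 2 ≤ m) :
    IsDerivativeFrame Q.D (Q.Fil 1) (2 * m) U w e where
  isOpen := h.isOpen
  isHolSection j _ i := h.isHolSection j i
  ne_zero := h.ne_zero
  deriv j _ i x _ := h.deriv j i x
  span x hx := (h.frame x hx).2
  linearIndependent x hx := Fintype.linearIndependent_iff.2 fun c hc ↦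
    congrFun (h.coeff_eq_zero hm hx c fun q ↦ by rw [hc]; simp)

end IsTower

/-! ### Transport to the dual bundle through B. -/

theorem B_injective (Q : GeneralizedQuasioper F E n m) (x : X) :
    Function.Injective (Q.B x) := by
  refine (injective_iff_map_eq_zero _).2 fun a ha ↦ Q.isSOStructure.nondegenerate x a fun f ↦ ?_
  rw [Q.isSOStructure.symm, ha]
  rfl

theorem exists_B_eq (Q : GeneralizedQuasioper F E n m) (x : X) (φ : E x →ₗ[ℂ] ℂ) :
    ∃ a : E x, ∀ f, Q.B x a f = φ f := by
  have := finiteDimensional_fiber (E := E) F x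
  let β : E x →ₗ[ℂ] Module.Dual ℂ (E x) :=
    (ContinuousLinearMap.coeLM ℂ : (E x →L[ℂ] ℂ) →ₗ[ℂ] E x →ₗ[ℂ] ℂ) ∘ₗ
      (Q.B x : E x →ₗ[ℂ] E x →L[ℂ] ℂ)
  have hβ : Function.Injective β := ContinuousLinearMap.coe_injective.comp (Q.B_injective x)
  obtain ⟨a, ha⟩ := (LinearMap.injective_iff_surjective_of_finrank_eq_finrank
    Subspace.dual_finrank_eq.symm).1 hβ φ
  exact ⟨a, LinearMap.congr_fun ha⟩

/-- A vector orthogonal to `F_{2m} = F₁^⊥` lies in `F₁`. -/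
theorem mem_fil_one (Q : GeneralizedQuasioper F E n m) (hm : 2 ≤ m) {x : X} {a : E x}
    (ha : ∀ f ∈ Q.Fil (2 * m) x, Q.B x a f = 0) : a ∈ Q.Fil 1 x := by
  by_contra hna
  -- A functional separating `a` from F₁ is B(b, ·) for some b in F₁^⊥ = F_{2m}, against which `a`
  -- pairs to zero.
  obtain ⟨φ, hφa, hφ⟩ := Submodule.exists_le_ker_of_notMem hna
  obtain ⟨b, hb⟩ := Q.exists_B_eq x φ
  refine hφa ?_
  rw [← hb, Q.isSOStructure.symm]
  refine ha b ((Q.isFiltration.perp 1 (by omega) x b).1 fun f hf ↦ ?_)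
  rw [Q.isSOStructure.symm, hb]
  exact hφ hf

theorem mem_dualFil_one_iff (Q : GeneralizedQuasioper F E n m) (hm : 2 ≤ m) {x : X}
    {φ : DualBundle E x} : φ ∈ Q.dualFil 1 x ↔ ∃ a ∈ Q.Fil 1 x, Q.B x a = φ := by
  have h1 : φ ∈ Q.dualFil 1 x ↔ ∀ f ∈ Q.Fil (2 * m) x, φ f = 0 := by
    rw [dualFil, LinearMap.mem_ker, Nat.add_sub_cancel]
    exact ⟨fun h f hf ↦ LinearMap.congr_fun h ⟨f, hf⟩, fun h ↦ LinearMap.ext fun f ↦ h f f.2⟩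
  rw [h1]
  constructor
  · intro h
    obtain ⟨a, ha⟩ := Q.exists_B_eq x (φ : E x →L[ℂ] ℂ)
    exact ⟨a, Q.mem_fil_one hm fun f hf ↦ (ha f).trans (h f hf), ContinuousLinearMap.ext ha⟩
  · rintro ⟨a, ha, rfl⟩ f hf
    exact (Q.isFiltration.perp 1 (by omega) x f).2 hf a ha

theorem IsTower.isDerivativeFrame_flat {Q : GeneralizedQuasioper F E n m} {U : Set X}
    {w : Π x : X, TangentSpace 𝓘(ℂ) x} {r : ℕ} {e : ℕ → Fin r → Π x, E x}
    (h : Q.IsTower U w e) (hm : 2 ≤ m) :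
    IsDerivativeFrame Q.dualD (Q.dualFil 1) (2 * m) U w fun j i ↦ Q.flat (e j i) where
  isOpen := h.isOpen
  isHolSection j _ i := Q.isHolSection_flat (h.isHolSection j i)
  ne_zero := h.ne_zero
  deriv j _ i x hx := by
    rw [Q.dualD_flat h.isOpen (h.isHolSection j i) hx, ← h.deriv]
    rfl
  span x hx := by
    ext φ
    rw [Q.mem_dualFil_one_iff hm, ← (h.frame x hx).2]
    have hrange : (Set.range fun i ↦ Q.flat (e 0 i) x) =
        (Q.B x : E x →ₗ[ℂ] E x →L[ℂ] ℂ) '' Set.range fun i ↦ e 0 i x :=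
      (Set.range_comp _ _)
    rw [hrange, ← Submodule.map_span]
    exact Iff.rfl
  linearIndependent x hx :=
    ((h.isDerivativeFrame hm).linearIndependent x hx).map'
      (Q.B x : E x →ₗ[ℂ] E x →L[ℂ] ℂ) (LinearMap.ker_eq_bot.2 (Q.B_injective x))

theorem exists_derivativeFrame (Q : GeneralizedQuasioper F E n m) (hm : 2 ≤ m) (x₀ : X) :
    ∃ (U : Set X) (w : Π x : X, TangentSpace 𝓘(ℂ) x) (r : ℕ) (e : ℕ → Fin r → Π x, E x),
      x₀ ∈ U ∧ IsDerivativeFrame Q.D (Q.Fil 1) (2 * m) U w e := by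
  obtain ⟨U, w, r, e, hx₀, h⟩ := Q.exists_isTower x₀
  exact ⟨U, w, r, e, hx₀, h.isDerivativeFrame hm⟩

theorem exists_derivativeFrame_dual (Q : GeneralizedQuasioper F E n m) (hm : 2 ≤ m) (x₀ : X) :
    ∃ (U : Set X) (w : Π x : X, TangentSpace 𝓘(ℂ) x) (r : ℕ)
      (e : ℕ → Fin r → Π x, DualBundle E x),
      x₀ ∈ U ∧ IsDerivativeFrame Q.dualD (Q.dualFil 1) (2 * m) U w e := by
  obtain ⟨U, w, r, e, hx₀, h⟩ := Q.exists_isTower x₀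
  exact ⟨U, w, r, _, hx₀, h.isDerivativeFrame_flat hm⟩

/-- The image of the dual of a quotient map is the annihilator of the subspace divided out. -/
theorem mem_bundleS_iff_bundleG (Q : GeneralizedQuasioper F E n m) {x : X} {a : E x} :
    a ∈ Q.bundleS x ↔ ∀ φ ∈ Q.bundleG x, φ a = 0 := by
  rw [bundleS, Submodule.mem_comap, Submodule.range_dualMap_mkQ_eq, Submodule.mem_dualAnnihilator]
  exact Iff.rfl

namespace IsTower

variable {Q : GeneralizedQuasioper F E n m} {U : Set X} {w : Π x : X, TangentSpace 𝓘(ℂ) x}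
  {r : ℕ} {e : ℕ → Fin r → Π x, E x}

theorem bundleF_eq (h : Q.IsTower U w e) (hm : 2 ≤ m) {x : X} (hx : x ∈ U) :
    Q.bundleF x = frameSpan e (2 * m) x :=
  iterSaturation_eq_frameSpan (Q.exists_derivativeFrame hm) le_rfl U w r e
    (h.isDerivativeFrame hm) x hx

theorem mem_bundleS_iff (h : Q.IsTower U w e) (hm : 2 ≤ m) {x : X} (hx : x ∈ U) {a : E x} :
    a ∈ Q.bundleS x ↔ ∀ q : Fin (2 * m + 1) × Fin r, Q.B x (e q.1 q.2 x) a = 0 := by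
  have hG : Q.bundleG x = frameSpan (fun j i ↦ Q.flat (e j i)) (2 * m) x :=
    iterSaturation_eq_frameSpan (Q.exists_derivativeFrame_dual hm) le_rfl U w r _
      (h.isDerivativeFrame_flat hm) x hx
  rw [mem_bundleS_iff_bundleG, hG]
  constructor
  · exact fun ha q ↦ ha _ (Submodule.subset_span ⟨q, rfl⟩)
  · intro ha φ hφ
    induction hφ using Submodule.span_induction with
    | mem φ hφ => obtain ⟨q, rfl⟩ := hφ; exact ha q
    | zero => rfl
    | add φ ψ _ _ h1 h2 => exact (congrArg₂ (· + ·) h1 h2).trans (add_zero _)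
    | smul c φ _ h1 => exact (congrArg (c • ·) h1).trans (smul_zero c)

end IsTower

/-! ### The orthogonal decomposition and its holomorphy. -/

theorem orthogonal (Q : GeneralizedQuasioper F E n m) (hm : 2 ≤ m) {x : X} {a b : E x}
    (ha : a ∈ Q.bundleF x) (hb : b ∈ Q.bundleS x) : Q.B x a b = 0 := by
  obtain ⟨U, w, r, e, hx, h⟩ := Q.exists_isTower x
  rw [h.bundleF_eq hm hx] at ha
  obtain ⟨c, rfl⟩ := mem_span_range_iff_exists_sum.1 ha
  simp only [map_sum, map_smul, sum_apply, smul_apply, (h.mem_bundleS_iff hm hx).1 hb, smul_zero,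
    Finset.sum_const_zero]

/-- The Gram matrix of the sections `e j i`, `j ≤ 2m`. -/
def gram (Q : GeneralizedQuasioper F E n m) {r : ℕ} (e : ℕ → Fin r → Π x, E x) (x : X) :
    Matrix (Fin (2 * m + 1) × Fin r) (Fin (2 * m + 1) × Fin r) ℂ :=
  Matrix.of fun q p ↦ Q.B x (e q.1 q.2 x) (e p.1 p.2 x)

theorem gram_mulVec (Q : GeneralizedQuasioper F E n m) {r : ℕ} (e : ℕ → Fin r → Π x, E x) (x : X)
    (c : Fin (2 * m + 1) × Fin r → ℂ) (q : Fin (2 * m + 1) × Fin r) :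
    (Q.gram e x).mulVec c q = Q.B x (e q.1 q.2 x) (∑ p, c p • e p.1 p.2 x) := by
  simp [gram, Matrix.mulVec, dotProduct, mul_comm]

theorem IsTower.det_gram_ne_zero {Q : GeneralizedQuasioper F E n m} {U : Set X}
    {w : Π x : X, TangentSpace 𝓘(ℂ) x} {r : ℕ} {e : ℕ → Fin r → Π x, E x}
    (h : Q.IsTower U w e) (hm : 2 ≤ m) {x : X} (hx : x ∈ U) : (Q.gram e x).det ≠ 0 := by
  intro h0
  obtain ⟨c, hc0, hc⟩ := Matrix.exists_mulVec_eq_zero_iff.2 h0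
  refine hc0 (h.coeff_eq_zero hm hx c fun q ↦ ?_)
  rw [Q.isSOStructure.symm, ← gram_mulVec, hc]
  rfl

/-- Fibrewise, 𝒮 is the orthogonal complement of 𝔽, and B is nondegenerate on 𝔽. Disjointness is
injectivity of the Gram matrix; spanning is its surjectivity, which provides the orthogonal
projection. -/
theorem isCompl (Q : GeneralizedQuasioper F E n m) (hm : 2 ≤ m) (x : X) :
    IsCompl (Q.bundleF x) (Q.bundleS x) := by
  obtain ⟨U, w, r, e, hx, h⟩ := Q.exists_isTower x
  constructor
  · rw [Submodule.disjoint_def]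
    intro a ha hb
    rw [h.bundleF_eq hm hx] at ha
    obtain ⟨c, rfl⟩ := mem_span_range_iff_exists_sum.1 ha
    have hc : c = 0 := h.coeff_eq_zero hm hx c fun q ↦ by
      rw [Q.isSOStructure.symm]
      exact (h.mem_bundleS_iff hm hx).1 hb q
    simp [hc]
  · rw [codisjoint_iff, eq_top_iff]
    intro a _
    obtain ⟨c, hc⟩ : ∃ c, (Q.gram e x).mulVec c = fun q ↦ Q.B x (e q.1 q.2 x) a :=
      (Matrix.mulVec_surjective_iff_isUnit.2 ((Matrix.isUnit_iff_isUnit_det _).2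
        (h.det_gram_ne_zero hm hx).isUnit)) _
    refine Submodule.mem_sup.2 ⟨∑ p : Fin (2 * m + 1) × Fin r, c p • e p.1 p.2 x, ?_,
      a - ∑ p : Fin (2 * m + 1) × Fin r, c p • e p.1 p.2 x, ?_, add_sub_cancel _ _⟩
    · rw [h.bundleF_eq hm hx]
      exact mem_span_range_iff_exists_sum.2 ⟨c, rfl⟩
    · refine (h.mem_bundleS_iff hm hx).2 fun q ↦ ?_
      rw [map_sub, ← gram_mulVec, hc, sub_self]

theorem isHolDirectSum (Q : GeneralizedQuasioper F E n m) (hm : 2 ≤ m) :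
    IsHolDirectSum F Q.bundleF Q.bundleS := by
  refine isHolDirectSum_of_isCompl ?_ (Q.isCompl hm) fun U s hU hs ↦ ?_
  -- Writing 2m as a successor presents 𝔽 as the result of at least one saturation, which is what
  -- makes it a subbundle.
  · obtain ⟨k, hk⟩ : ∃ k, 2 * m = k + 1 := ⟨2 * m - 1, by omega⟩
    rw [show Q.bundleF = iterSaturation F Q.D (k + 1) (Q.Fil 1) by rw [bundleF, hk]]
    exact isHolSubbundle_iterSaturation (Q.exists_derivativeFrame hm) (by omega)
  have hex (x : X) : ∃ a ∈ Q.bundleF x, ∃ b ∈ Q.bundleS x, a + b = s x :=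
    Submodule.mem_sup.1 ((Q.isCompl hm x).sup_eq_top ▸ Submodule.mem_top)
  choose a ha b hb hab using hex
  have hahol : IsHolSection F U a := by
    intro x hx
    obtain ⟨U', w, r, e, hx', h⟩ := Q.exists_isTower x
    have hex (y : X) : ∃ c : Fin (2 * m + 1) × Fin r → ℂ, y ∈ U' →
        ∑ p, c p • e p.1 p.2 y = a y := by
      by_cases hy : y ∈ U'
      · obtain ⟨c, hc⟩ := mem_span_range_iff_exists_sum.1 (h.bundleF_eq hm hy ▸ ha y)
        exact ⟨c, fun _ ↦ hc⟩
      · exact ⟨0, fun hy' ↦ absurd hy' hy⟩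
    choose c hc using hex
    have hcs (p) : ContMDiffAt 𝓘(ℂ) 𝓘(ℂ) ω (fun y ↦ c y p) x := by
      -- Since s - a lies in 𝒮 = 𝔽^⊥, the coordinates of `a` solve the Gram system whose right-hand
      -- side is B(e j i, s), which is holomorphic.
      refine contMDiffAt_of_mulVec_eq (A := Q.gram e) (b := fun y q ↦ Q.B y (e q.1 q.2 y) (s y))
        (fun q p ↦ ?_) (fun q ↦ ?_) (h.det_gram_ne_zero hm hx') ?_ p
      · exact (Q.contMDiffOn_B (h.isHolSection _ _) (h.isHolSection _ _)).contMDiffAt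
          (h.isOpen.mem_nhds hx')
      · exact (Q.contMDiffOn_B ((h.isHolSection _ _).mono Set.inter_subset_left)
          (hs.mono Set.inter_subset_right)).contMDiffAt ((h.isOpen.inter hU).mem_nhds ⟨hx', hx⟩)
      · filter_upwards [h.isOpen.mem_nhds hx'] with y hy
        ext q
        rw [gram_mulVec, hc y hy, ← hab y, map_add, (h.mem_bundleS_iff hm hy).1 (hb y) q,
          add_zero]
    have hsum : CMDiffAt ω (T% fun y ↦ ∑ p : Fin (2 * m + 1) × Fin r, c y p • e p.1 p.2 y) x :=
      ContMDiffAt.sum_section fun p _ ↦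
        (hcs p).smul_section ((h.isHolSection _ _).contMDiffAt h.isOpen hx')
    refine (hsum.congr_of_eventuallyEq ?_).contMDiffWithinAt
    filter_upwards [h.isOpen.mem_nhds hx'] with y hy
    rw [hc y hy]
  refine ⟨a, b, hahol, ?_, fun x _ ↦ ⟨ha x, hb x, hab x⟩⟩
  have hsub : IsHolSection F U (s - a) := ContMDiffOn.sub_section hs hahol
  exact hsub.congr fun x _ ↦ by simp [← hab x]

end GeneralizedQuasioper

end SOQuasioper

end

theorem lemma3p2
    {X : Type*} [TopologicalSpace X] [T2Space X] [CompactSpace X] [ConnectedSpace X]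
    [ChartedSpace ℂ X] [IsManifold 𝓘(ℂ) ω X]
    {F : Type*} [NormedAddCommGroup F] [NormedSpace ℂ F] [FiniteDimensional ℂ F]
    {E : X → Type*} [TopologicalSpace (TotalSpace F E)]
    [∀ x, AddCommGroup (E x)] [∀ x, Module ℂ (E x)] [∀ x, TopologicalSpace (E x)]
    [∀ x, IsTopologicalAddGroup (E x)] [∀ x, ContinuousSMul ℂ (E x)]
    [FiberBundle F E] [VectorBundle ℂ F E] [ContMDiffVectorBundle ω F E 𝓘(ℂ)]
    {n m : ℕ} (hn : 2 ≤ n) (hm : 2 ≤ m)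
    (Q : SOQuasioper.GeneralizedQuasioper F E n m) :
    -- the iterated minimal saturations of `F₁` and `G₁` exist
    (∀ k < 2 * m, IsLeast
      (SOQuasioper.saturations F Q.D (SOQuasioper.iterSaturation F Q.D k (Q.Fil 1)))
      (SOQuasioper.iterSaturation F Q.D (k + 1) (Q.Fil 1))) ∧
    (∀ k < 2 * m, IsLeast
      (SOQuasioper.saturations (F →L[ℂ] ℂ) Q.dualD
        (SOQuasioper.iterSaturation (F →L[ℂ] ℂ) Q.dualD k (Q.dualFil 1)))
      (SOQuasioper.iterSaturation (F →L[ℂ] ℂ) Q.dualD (k + 1) (Q.dualFil 1))) ∧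
    -- `E = 𝔽 ⊕ 𝒮` as holomorphic vector bundles
    SOQuasioper.IsHolDirectSum F Q.bundleF Q.bundleS ∧
    -- the decomposition is orthogonal
    (∀ x, ∀ a ∈ Q.bundleF x, ∀ b ∈ Q.bundleS x, Q.B x a b = 0) := by
  exact ⟨fun _ hk ↦ SOQuasioper.isLeast_iterSaturation_succ (Q.exists_derivativeFrame hm) hk,
    fun _ hk ↦ SOQuasioper.isLeast_iterSaturation_succ (Q.exists_derivativeFrame_dual hm) hk,
    Q.isHolDirectSum hm, fun _ _ ha _ hb ↦ Q.orthogonal hm ha hb⟩
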